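/- \textbf{Definitions.} A \emph{polymatroid} $(E,f)$ is a set $E$ with a function $f:\mathcal P(E)\to\mathbb R$ such that $f(\emptyset)=0$, $f(A)\le f(B)$ whenever $A\subseteq B\subseteq E$, and $f(A)+f(B)\ge f(A\cup B)+f(A\cap B)$ for all $A,B\subseteq E$. It is \emph{of finite type} if $f(A)=\sup\{f(F)\mid F\subseteq A\text{ finite}\}$ for all $A\subseteq E$. Write $\mathrm{cl}(A)=\{x\in E\mid f(A\cup\{x\})=f(A)\}$ and $f(a_1,\dots,a_k)=f(\{a_1,\dots,a_k\})$. A function $h:\mathcal P(E)\to\mathbb R$ is \emph{entropic} if there are random variables $(X_i)_{i\in E}$ on a finite probability space such that $h(T)$ is the Shannon entropy (to base $2$) of $X_T=(X_i)_{i\in T}$ for every $T\subseteq E$. A polymatroid $(E,f)$ is \emph{almost entropic} if it is of finite type and $f$ is a pointwise limit of a sequence of entropic functions on $\mathcal P(E)$. A \emph{partial Dowling geometry (PDG) of rank $r$} is a triple $(E,f,S)$ such that $(E,f)$ is a polymatroid and: \begin{enumerate} \item $S$ is a set with an involution $s\mapsto s^{-1}$ and a distinguished element $e$ with $e^{-1}=e$;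 \item $E$ contains a distinguished basis $B=\{b_1,\dots,b_r\}$ of $r$ distinct elements, with $f(A)=|A|$ for all $A\subseteq B$; \item for each $1\le i<j\le r$, $E$ contains a copy $\{s_{i,j}\mid s\in S\}$ of $S$, and $E=B\sqcup\bigsqcup_{i<j}\{s_{i,j}\mid s\in S\}$; for $i<j$ put $s_{j,i}:=(s^{-1})_{i,j}$; \item $s_{i,j}\in\mathrm{cl}(\{b_i,b_j\})$ for all $s\in S$ and all distinct $i,j$; \item $f(s_{i,j})=1$ and $f(b_i,s_{i,j})=2$ for all $s\in S$ and all distinct $i,j$; \item $f(s_{i,j},(s^{-1})_{j,k},e_{k,i})=2$ for all $s\in S$ and all pairwise distinct $i,j,k$. \end{enumerate} A \emph{relator} is a triple $(s,s',s'')\in S^3$ with $f(s_{i,j},s'_{j,k},s''_{k,i})=2$ for all pairwise distinct $i,j,k$. A \emph{geometric product} of $s,s'\in S$ is an element $t\in S$ such that $(s,s',t^{-1})$ is a relator. A PDG $(\tilde E,\tilde f,\tilde S)$ of rank $r$ is an \emph{extension} of $(E,f,S)$ if $E\subseteq\tilde E$, $S\subseteq\tilde S$, $\tilde f(A)=f(A)$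 for all $A\subseteq E$, the involution of $\tilde S$ restricts to that of $S$, and both PDGs have the same $e$, the same $b_1,\dots,b_r$, and the same elements $s_{i,j}$ for $s\in S$. \textbf{Theorem (a product-closed extension).} Let $(E,f,S)$ be a partial Dowling geometry of rank $4$ with $E$ finite and $(E,f)$ almost entropic. Then there exists an extension $(\tilde E,\tilde f,\tilde S)$ of $(E,f,S)$, which is again a partial Dowling geometry of rank $4$ with $(\tilde E,\tilde f)$ almost entropic, such that for all $s,s'\in\tilde S$ (not necessarily distinct) there exists a geometric product $t\in\tilde S$ of $s$ and $s'$. -/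

import Mathlib

universe u v

noncomputable section

/-! ## Polymatroids -/

/-- A set function `f` on the subsets of the ground set `E` (all of the type `E`) is the rank
function of a polymatroid. -/
structure IsPolymatroid {E : Type*} (f : Set E → ℝ) : Prop where
  map_empty : f ∅ = 0
  mono : ∀ ⦃A B : Set E⦄, A ⊆ B → f A ≤ f B
  submodular : ∀ A B : Set E, f (A ∪ B) + f (A ∩ B) ≤ f A + f B

/-- The rank of every set is the supremum of the ranks of its finite subsets. -/
def IsFiniteType {E : Type*} (f : Set E → ℝ) : Prop :=
  ∀ A : Set E, IsLUB {x : ℝ | ∃ F : Set E, F.Finite ∧ F ⊆ A ∧ x = f F} (f A)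

/-- The closure operator of a polymatroid. -/
def polyClosure {E : Type*} (f : Set E → ℝ) (A : Set E) : Set E :=
  {x | f A = f (A ∪ {x})}

/-! ## Entropy -/

/-- The probability of the event `X = x`, for a random variable `X` on the finite probability
space with underlying set `Ω` and point masses `p`. -/
def probEq {Ω : Type*} [Fintype Ω] (p : Ω → ℝ) {A : Type*} (X : Ω → A) (x : A) : ℝ :=
  open Classical in ∑ ω with X ω = x, p ω

/-- The Shannon entropy (in bits) of a random variable `X` on the finite probability space
`(Ω, p)`. Only finitely many values `x` give a nonzero summand. -/
def shannonEntropy {Ω : Type*} [Fintype Ω] (p : Ω → ℝ) {A : Type*} (X : Ω → A) : ℝ :=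
  ∑ᶠ x : A, probEq p X x * Real.logb 2 (1 / probEq p X x)

/-- `h` is entropic: `h T` is the joint entropy of `(X i)` for `i ∈ T`, for some family of random
variables `X i`, `i ∈ E`, on a finite probability space. -/
def IsEntropic {E : Type*} (h : Set E → ℝ) : Prop :=
  ∃ (Ω : Type) (_ : Fintype Ω) (p : Ω → ℝ) (_ : p ∈ stdSimplex ℝ Ω)
    (A : E → Type) (X : (i : E) → Ω → A i),
    ∀ T : Set E, h T = shannonEntropy p (fun (ω : Ω) (i : T) => X i ω)

/-- An almost entropic polymatroid: a polymatroid of finite type which is a pointwise limit of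
entropic polymatroids on the same ground set. -/
structure IsAlmostEntropic {E : Type*} (h : Set E → ℝ) : Prop where
  isPolymatroid : IsPolymatroid h
  isFiniteType : IsFiniteType h
  exists_limit : ∃ g : ℕ → Set E → ℝ, (∀ n, IsEntropic (g n)) ∧
    ∀ T : Set E, Filter.Tendsto (fun n => g n T) Filter.atTop (nhds (h T))

/-! ## Partial Dowling geometries -/

/-- The data of a partial Dowling geometry of rank `r` with ground set `E` and generating set `S`;
the axioms are collected in `PDGData.IsPDG`. -/
structure PDGData (r : ℕ) (E : Type u) (S : Type v) where
  /-- the rank function -/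
  rank : Set E → ℝ
  /-- the involution of the generating set -/
  inv : S → S
  /-- the distinguished generator -/
  e : S
  /-- the distinguished basis -/
  b : Fin r → E
  /-- for `i < j`, the `(i, j)`-th copy of the generating set -/
  copy : {p : Fin r × Fin r // p.1 < p.2} → S → E

namespace PDGData

variable {r : ℕ} {E : Type u} {S : Type v}

/-- The element `s_{i,j}` for arbitrary distinct `i`, `j`: for `i < j` it is the copy of `s` with
these indices, and for `j < i` it is `(s⁻¹)_{j,i}`. -/
def elt (P : PDGData r E S) (s : S) (i j : Fin r) (hij : i ≠ j) : E :=
  if h : i < j then P.copy ⟨(i, j), h⟩ s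
  else P.copy ⟨(j, i), lt_of_le_of_ne (not_lt.mp h) hij.symm⟩ (P.inv s)

/-- The axioms of a partial Dowling geometry of rank `r`. -/
structure IsPDG (P : PDGData r E S) : Prop where
  isPolymatroid : IsPolymatroid P.rank
  inv_involutive : Function.Involutive P.inv
  inv_e : P.inv P.e = P.e
  /-- `E` is the disjoint union of the `r`-element set `B = {b_1, …, b_r}` and of the copies of
  `S` indexed by the pairs `i < j`. -/
  bijective : Function.Bijective
    (Sum.elim P.b (fun x : {p : Fin r × Fin r // p.1 < p.2} × S => P.copy x.1 x.2))
  /-- the distinguished basis is independent -/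
  rank_basis : ∀ A : Set E, A ⊆ Set.range P.b → P.rank A = (A.ncard : ℝ)
  frame : ∀ (s : S) (i j : Fin r) (hij : i ≠ j),
    P.elt s i j hij ∈ polyClosure P.rank {P.b i, P.b j}
  rank_elt : ∀ (s : S) (i j : Fin r) (hij : i ≠ j), P.rank {P.elt s i j hij} = 1
  rank_basis_elt : ∀ (s : S) (i j : Fin r) (hij : i ≠ j),
    P.rank {P.b i, P.elt s i j hij} = 2
  coherence : ∀ (s : S) (i j k : Fin r) (hij : i ≠ j) (hjk : j ≠ k) (hki : k ≠ i),
    P.rank {P.elt s i j hij, P.elt (P.inv s) j k hjk, P.elt P.e k i hki} = 2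

/-- `(s, s', s'')` is a relator. -/
def IsRelator (P : PDGData r E S) (s s' s'' : S) : Prop :=
  ∀ (i j k : Fin r) (hij : i ≠ j) (hjk : j ≠ k) (hki : k ≠ i),
    P.rank {P.elt s i j hij, P.elt s' j k hjk, P.elt s'' k i hki} = 2

/-- `t` is a geometric product of `s` and `s'`. -/
def IsGeometricProduct (P : PDGData r E S) (s s' t : S) : Prop :=
  P.IsRelator s s' (P.inv t)

/-- Any two generators, distinct or not, have a geometric product. -/
def IsProductClosed (P : PDGData r E S) : Prop :=
  ∀ s s' : S, ∃ t : S, P.IsGeometricProduct s s' t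

/-- `Q` is an extension of `P`, where `ι` and `κ` are the inclusions of the ground set and of the
generating set: all the structure of `P` is the restriction of that of `Q`. -/
structure IsExtension {E' : Type u} {S' : Type v} (P : PDGData r E S) (Q : PDGData r E' S')
    (ι : E ↪ E') (κ : S ↪ S') : Prop where
  rank_image : ∀ A : Set E, Q.rank (ι '' A) = P.rank A
  map_inv : ∀ s : S, κ (P.inv s) = Q.inv (κ s)
  map_e : κ P.e = Q.e
  map_b : ∀ i : Fin r, ι (P.b i) = Q.b i
  map_copy : ∀ (p : {p : Fin r × Fin r // p.1 < p.2}) (s : S), ι (P.copy p s) = Q.copy p (κ s)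

end PDGData

end

/-! A product of `s` and `s'` should be the point `t_{i,j}` in which the line through `s_{i,k}` and
`s'_{k,j}` meets the line through `b_i` and `b_j`. Both lines lie in the plane of `b_i, b_j, b_k`,
but a polymatroid need not contain a meeting point, and in general no extension need provide one.
Limits of entropic functions do extend, by the Ahlswede–Körner lemma
(`IsEntropicLimit.exists_commonInformation`): for finite sets `W`, `Y` a new element `z` can be
given rank at least the mutual information `f W + f Y - f (W ∪ Y)`, with `f (A ∪ z) ≤ f (A ∪ Y) + f
W - f (W ∪ Y)` for every `A ⊆ W`.

Rank 4 supplies a useful `Y`. With a fourth index `l`, the point `e_{k,l}` projects `s_{i,k},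
s'_{k,j}` to `s_{i,l}, s'_{l,j}`. Let `Y` be this second pair and `W` the pair `b_i, b_j` together
with the first pair. The mutual information is 3 + 2 - 4 = 1, and the bounds for the two lines
inside `W` put `z` on both of them (`IsEntropicLimit.exists_joint`).

The Ahlswede–Körner lemma is proved with groups. Every entropic function is a limit of normalized
log-indices of subgroup families, by counting permutations of type classes
(`IsEntropic.exists_subgroups`). For subgroups `H`, `L` of a finite group `Γ`, few translates of `L
* H` cover `Γ`. The name of a translate containing `g` is a variable whose entropy is the mutual
information of the two quotients, up to a double logarithm (`Subgroup.exists_codebook`).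
Normalization removes this error, erasing a variable with high probability realizes division by `N`,
and compactness over a finite ground set gives exact inequalities.

The points `t_{i,j}` are added one ordered pair `(i, j)` at a time, each through an arbitrary middle
index. No compatibility has to be imposed: two distinct planes in rank 4 meet in rank at most 2,
which forces the relator for every middle index (`IsFrame.product_change_middle`) and the coherence
of `t` (`IsFrame.product_coherence`). Adjoining all formal products in a chain of finite stages and
taking the union gives the extension. -/

noncomputable section

open Finset

/-! ## Entropy of equivalence relations on a finite probability space -/

section Entropy

variable {Ω : Type*} [Fintype Ω]

/-- The probability of the class of `ω`. -/
def classMass (p : Ω → ℝ) (R : Setoid Ω) (ω : Ω) : ℝ :=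
  open Classical in ∑ α with R α ω, p α

/-- The entropy (in bits) of the partition into the classes of `R`. -/
def setoidEntropy (p : Ω → ℝ) (R : Setoid Ω) : ℝ :=
  ∑ ω, p ω * Real.logb 2 (1 / classMass p R ω)

/-- Entropy depends only on the partition into fibres. Working with partitions of the sample space
removes the value types, and a joint variable becomes an infimum of equivalence relations. -/
theorem shannonEntropy_eq_setoidEntropy (p : Ω → ℝ) {A : Type*} (X : Ω → A) :
    shannonEntropy p X = setoidEntropy p (Setoid.ker X) := by
  classical
  unfold shannonEntropy setoidEntropy
  rw [finsum_eq_sum_of_support_subset (s := univ.image X)]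
  · rw [← Finset.sum_fiberwise_of_maps_to (s := univ) (t := univ.image X) (g := X)
      (fun ω _ => mem_image_of_mem _ (mem_univ _))]
    refine Finset.sum_congr rfl fun x _ => ?_
    unfold probEq
    rw [Finset.sum_mul]
    refine Finset.sum_congr (by ext; simp) fun ω hω => ?_
    simp only [mem_filter, mem_univ, true_and] at hω
    subst hω
    congr 3
  · intro x hx
    by_contra hx'
    apply hx
    have : probEq p X x = 0 := by
      unfold probEq
      rw [Finset.sum_eq_zero]
      intro ω hω
      simp only [mem_filter, mem_univ, true_and] at hω
      exact absurd (by simp [← hω]) hx'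
    simp [this]

theorem classMass_nonneg {p : Ω → ℝ} (hp : ∀ ω, 0 ≤ p ω) (R : Setoid Ω) (ω : Ω) :
    0 ≤ classMass p R ω := Finset.sum_nonneg fun _ _ => hp _

theorem le_classMass {p : Ω → ℝ} (hp : ∀ ω, 0 ≤ p ω) (R : Setoid Ω) (ω : Ω) :
    p ω ≤ classMass p R ω := by
  classical
  exact Finset.single_le_sum (f := p) (fun _ _ => hp _) (by simp)

theorem classMass_mono {p : Ω → ℝ} (hp : ∀ ω, 0 ≤ p ω) {R S : Setoid Ω} (h : R ≤ S) (ω : Ω) :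
    classMass p R ω ≤ classMass p S ω := by
  classical
  refine Finset.sum_le_sum_of_subset_of_nonneg (fun α hα => ?_) fun _ _ _ => hp _
  simp only [mem_filter, mem_univ, true_and] at hα ⊢
  exact h hα

theorem classMass_congr (p : Ω → ℝ) (R : Setoid Ω) {ω ω' : Ω} (h : R ω ω') :
    classMass p R ω = classMass p R ω' := by
  classical
  unfold classMass
  congr 1
  ext α
  simp only [mem_filter, mem_univ, true_and]
  exact ⟨fun hα => R.trans hα h, fun hα => R.trans hα (R.symm h)⟩

theorem setoidEntropy_anti {p : Ω → ℝ} (hp : ∀ ω, 0 ≤ p ω) {R S : Setoid Ω} (h : R ≤ S) :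
    setoidEntropy p S ≤ setoidEntropy p R := by
  refine Finset.sum_le_sum fun ω _ => ?_
  rcases (hp ω).eq_or_lt with h0 | h0
  · simp [← h0]
  · have h1 := h0.trans_le (le_classMass hp R ω)
    exact mul_le_mul_of_nonneg_left (Real.logb_le_logb_of_le one_lt_two
      (by have := h1.trans_le (classMass_mono hp h ω); positivity)
      (one_div_le_one_div_of_le h1 (classMass_mono hp h ω))) (hp ω)

theorem setoidEntropy_top {p : Ω → ℝ} (hp : p ∈ stdSimplex ℝ Ω) :
    setoidEntropy p ⊤ = 0 := by
  refine Finset.sum_eq_zero fun ω _ => ?_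
  have : classMass p ⊤ ω = 1 := by
    rw [← hp.2]; unfold classMass
    congr 1; ext; simp [Setoid.top_def]
  simp [this]

/-- Gibbs' inequality, in the form of a Jensen inequality for the logarithm. -/
theorem sum_mul_logb_nonpos {p r : Ω → ℝ} (hp : p ∈ stdSimplex ℝ Ω)
    (hr : ∀ ω, 0 < p ω → 0 < r ω) (h : ∑ ω, p ω * r ω ≤ 1) :
    ∑ ω, p ω * Real.logb 2 (r ω) ≤ 0 := by
  have hlog : 0 < Real.log 2 := Real.log_pos one_lt_two
  have key : ∑ ω, p ω * Real.log (r ω) ≤ 0 := by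
    calc ∑ ω, p ω * Real.log (r ω) ≤ ∑ ω, (p ω * r ω - p ω) := by
          refine Finset.sum_le_sum fun ω _ => ?_
          rcases (hp.1 ω).eq_or_lt with h0 | h0
          · simp [← h0]
          · have := Real.log_le_sub_one_of_pos (hr ω h0)
            nlinarith
      _ ≤ 0 := by rw [Finset.sum_sub_distrib, hp.2]; linarith
  have : ∑ ω, p ω * Real.logb 2 (r ω) = (∑ ω, p ω * Real.log (r ω)) / Real.log 2 := by
    rw [Finset.sum_div]
    exact Finset.sum_congr rfl fun ω _ => by rw [Real.logb]; ring
  rw [this]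
  exact div_nonpos_of_nonpos_of_nonneg key hlog.le

/-- All terms share one denominator, the mass of the class containing `s`. Equality can fail because
`s` may be only a part of the class, or the class may have mass 0. -/
theorem sum_div_classMass_le_one {p : Ω → ℝ} (hp : ∀ ω, 0 ≤ p ω) (R : Setoid Ω)
    (s : Finset Ω) (hs : ∀ ω ∈ s, ∀ ω' ∈ s, R ω ω') :
    ∑ ω ∈ s, p ω / classMass p R ω ≤ 1 := by
  classical
  rcases s.eq_empty_or_nonempty with rfl | ⟨ω₀, h₀⟩
  · simp
  · rw [Finset.sum_congr rfl fun ω hω => by rw [classMass_congr p R (hs ω hω ω₀ h₀)],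
      ← Finset.sum_div]
    refine div_le_one_of_le₀ ?_ (classMass_nonneg hp R _)
    refine Finset.sum_le_sum_of_subset_of_nonneg (fun ω hω => ?_) fun _ _ _ => hp _
    simpa using hs ω hω ω₀ h₀

/-- This is nonnegativity of conditional mutual information: Gibbs' inequality applied to the ratio
of the conditionally independent law to the true one, whose mean is at most 1. -/
theorem setoidEntropy_submodular {p : Ω → ℝ} (hp : p ∈ stdSimplex ℝ Ω) {R S T : Setoid Ω}
    (hR : R ≤ T) (hS : S ≤ T) :
    setoidEntropy p (R ⊓ S) + setoidEntropy p T ≤ setoidEntropy p R + setoidEntropy p S := by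
  classical
  have hp0 := hp.1
  set r : Ω → ℝ := fun ω =>
    classMass p R ω * classMass p S ω / (classMass p (R ⊓ S) ω * classMass p T ω) with hrdef
  have key : ∑ ω, p ω * Real.logb 2 (r ω) ≤ 0 := by
    apply sum_mul_logb_nonpos hp
    · intro ω h0
      have h1 := h0.trans_le (le_classMass hp0 R ω)
      have h2 := h0.trans_le (le_classMass hp0 S ω)
      have h3 := h0.trans_le (le_classMass hp0 T ω)
      have h4 := h0.trans_le (le_classMass hp0 (R ⊓ S) ω)
      positivity
    -- Expanding the masses of the `R`- and `S`-classes turns the mean of `r` into a triple sum. For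
    -- fixed `α`, `β` the admissible `ω` lie in a single class of `R ⊓ S`, so the inner sum is at
    -- most 1.
    · have h1 : ∀ ω, p ω * r ω = ∑ α, ∑ β, if R α ω ∧ S β ω ∧ T β α then
          (p α * p β / classMass p T α) * (p ω / classMass p (R ⊓ S) ω) else 0 := by
        intro ω
        have : p ω * r ω = (∑ α with R α ω, p α) * (∑ β with S β ω, p β) *
            (p ω / (classMass p (R ⊓ S) ω * classMass p T ω)) := by
          simp only [hrdef, classMass]; ring
        rw [this, Finset.sum_mul_sum, Finset.sum_mul, Finset.sum_filter]
        refine Finset.sum_congr rfl fun α _ => ?_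
        by_cases hα : R α ω
        · rw [if_pos hα, Finset.sum_mul, Finset.sum_filter]
          refine Finset.sum_congr rfl fun β _ => ?_
          by_cases hβ : S β ω
          · have hT : T β α := T.trans (hS hβ) (T.symm (hR hα))
            rw [if_pos hβ, if_pos ⟨hα, hβ, hT⟩, classMass_congr p T (hR hα)]
            ring
          · rw [if_neg hβ, if_neg (by tauto)]
        · rw [if_neg hα]
          exact (Finset.sum_eq_zero fun β _ => by rw [if_neg (by tauto)]).symm
      calc ∑ ω, p ω * r ω = ∑ α, ∑ β, ∑ ω, if R α ω ∧ S β ω ∧ T β α then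
          (p α * p β / classMass p T α) * (p ω / classMass p (R ⊓ S) ω) else 0 := by
            rw [Finset.sum_congr rfl fun ω _ => h1 ω, Finset.sum_comm]
            exact Finset.sum_congr rfl fun α _ => Finset.sum_comm
        _ ≤ ∑ α, ∑ β, if T β α then p α * p β / classMass p T α else 0 := by
            refine Finset.sum_le_sum fun α _ => Finset.sum_le_sum fun β _ => ?_
            by_cases hT : T β α
            · rw [if_pos hT]
              have : ∑ ω, (if R α ω ∧ S β ω ∧ T β α then
                  (p α * p β / classMass p T α) * (p ω / classMass p (R ⊓ S) ω) else 0) =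
                  (p α * p β / classMass p T α) *
                    ∑ ω with R α ω ∧ S β ω, p ω / classMass p (R ⊓ S) ω := by
                rw [Finset.mul_sum, Finset.sum_filter]
                exact Finset.sum_congr rfl fun ω _ => by simp only [hT, and_true]
              rw [this]
              refine mul_le_of_le_one_right (div_nonneg (mul_nonneg (hp0 _) (hp0 _))
                (classMass_nonneg hp0 _ _)) (sum_div_classMass_le_one hp0 _ _ ?_)
              intro ω hω ω' hω'
              simp only [mem_filter, mem_univ, true_and] at hω hω'
              exact ⟨R.trans (R.symm hω.1) hω'.1, S.trans (S.symm hω.2) hω'.2⟩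
            · rw [if_neg hT]
              exact (Finset.sum_eq_zero fun ω _ => by rw [if_neg (by tauto)]).le
        _ ≤ ∑ α, p α := by
            refine Finset.sum_le_sum fun α _ => ?_
            rw [← Finset.sum_filter, ← Finset.sum_div, ← Finset.mul_sum, mul_div_assoc]
            exact mul_le_of_le_one_right (hp0 _) (div_self_le_one _)
        _ = 1 := hp.2
  have : ∑ ω, p ω * Real.logb 2 (r ω) = setoidEntropy p (R ⊓ S) + setoidEntropy p T
      - (setoidEntropy p R + setoidEntropy p S) := by
    unfold setoidEntropy
    rw [← Finset.sum_add_distrib, ← Finset.sum_add_distrib, ← Finset.sum_sub_distrib]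
    refine Finset.sum_congr rfl fun ω _ => ?_
    rcases (hp0 ω).eq_or_lt with h0 | h0
    · simp [← h0]
    · have h1 := (h0.trans_le (le_classMass hp0 R ω)).ne'
      have h2 := (h0.trans_le (le_classMass hp0 S ω)).ne'
      have h3 := (h0.trans_le (le_classMass hp0 T ω)).ne'
      have h4 := (h0.trans_le (le_classMass hp0 (R ⊓ S) ω)).ne'
      simp only [hrdef, one_div, Real.logb_inv]
      rw [Real.logb_div (mul_ne_zero h1 h2) (mul_ne_zero h4 h3), Real.logb_mul h1 h2,
        Real.logb_mul h4 h3]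
      ring
  linarith

/-- A random variable with values in a finite set `B` has entropy at most `log |B|`. -/
theorem setoidEntropy_ker_le {p : Ω → ℝ} (hp : p ∈ stdSimplex ℝ Ω) {B : Type*} [Fintype B]
    (X : Ω → B) : setoidEntropy p (Setoid.ker X) ≤ Real.logb 2 (Fintype.card B) := by
  classical
  have hp0 := hp.1
  have hΩ : Nonempty Ω := by
    by_contra h
    rw [not_nonempty_iff] at h
    have := hp.2
    simp at this
  have hB : (0 : ℝ) < Fintype.card B := by
    have := hΩ.map X
    exact_mod_cast Fintype.card_pos
  have key := sum_mul_logb_nonpos (r := fun ω => 1 / classMass p (Setoid.ker X) ω /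
    Fintype.card B) hp ?_ ?_
  · have : ∑ ω, p ω * Real.logb 2 (1 / classMass p (Setoid.ker X) ω / Fintype.card B) =
        setoidEntropy p (Setoid.ker X) - ∑ ω, p ω * Real.logb 2 (Fintype.card B) := by
      unfold setoidEntropy
      rw [← Finset.sum_sub_distrib]
      refine Finset.sum_congr rfl fun ω _ => ?_
      rcases (hp0 ω).eq_or_lt with h0 | h0
      · simp [← h0]
      · have h1 := (h0.trans_le (le_classMass hp0 (Setoid.ker X) ω)).ne'
        rw [Real.logb_div (by simpa using h1) hB.ne']
        ring
    rw [this, ← Finset.sum_mul, hp.2] at key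
    linarith
  · intro ω h0
    have h1 := h0.trans_le (le_classMass hp0 (Setoid.ker X) ω)
    positivity
  · have : ∀ ω, p ω * (1 / classMass p (Setoid.ker X) ω / Fintype.card B) =
        (p ω / classMass p (Setoid.ker X) ω) / Fintype.card B := fun ω => by ring
    rw [Finset.sum_congr rfl fun ω _ => this ω, ← Finset.sum_div, div_le_one hB,
      ← Finset.sum_fiberwise (s := univ) (g := X)]
    calc ∑ b : B, ∑ ω with X ω = b, p ω / classMass p (Setoid.ker X) ω ≤ ∑ b : B, (1 : ℝ) := by
          refine Finset.sum_le_sum fun b _ => sum_div_classMass_le_one hp0 _ _ ?_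
          intro ω hω ω' hω'
          simp only [mem_filter, mem_univ, true_and] at hω hω'
          rw [Setoid.ker_def, hω, hω']
      _ = _ := by simp

/-- If every class has probability at most `c`, then the entropy is at least `log (1 / c)`. -/
theorem le_setoidEntropy {p : Ω → ℝ} (hp : p ∈ stdSimplex ℝ Ω) (R : Setoid Ω) {c : ℝ}
    (h : ∀ ω, classMass p R ω ≤ c) : Real.logb 2 (1 / c) ≤ setoidEntropy p R := by
  have : Real.logb 2 (1 / c) = ∑ ω, p ω * Real.logb 2 (1 / c) := by
    rw [← Finset.sum_mul, hp.2, one_mul]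
  rw [this]
  refine Finset.sum_le_sum fun ω _ => ?_
  rcases (hp.1 ω).eq_or_lt with h0 | h0
  · simp [← h0]
  · have h1 := h0.trans_le (le_classMass hp.1 R ω)
    exact mul_le_mul_of_nonneg_left (Real.logb_le_logb_of_le one_lt_two
      (by have := h1.trans_le (h ω); positivity) (one_div_le_one_div_of_le h1 (h ω))) (hp.1 ω)

end Entropy

/-! ## Entropic functions -/

section Entropic

variable {E : Type*}

/-- The equivalence relation of the joint variable `X_T`. -/
def jointKer {Ω : Type*} {A : E → Type*} (X : (i : E) → Ω → A i) (T : Set E) : Setoid Ω :=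
  Setoid.ker fun (ω : Ω) (i : T) => X i ω

theorem jointKer_iff {Ω : Type*} {A : E → Type*} {X : (i : E) → Ω → A i} {T : Set E} {a b : Ω} :
    jointKer X T a b ↔ ∀ i ∈ T, X i a = X i b := by
  change (fun (i : T) => X i a) = (fun (i : T) => X i b) ↔ _
  rw [funext_iff]
  simp

theorem isEntropic_iff {h : Set E → ℝ} : IsEntropic h ↔
    ∃ (Ω : Type) (_ : Fintype Ω) (p : Ω → ℝ) (_ : p ∈ stdSimplex ℝ Ω)
    (A : E → Type) (X : (i : E) → Ω → A i), ∀ T, h T = setoidEntropy p (jointKer X T) := by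
  constructor
  · rintro ⟨Ω, _, p, hp, A, X, hX⟩
    exact ⟨Ω, _, p, hp, A, X, fun T => (hX T).trans (shannonEntropy_eq_setoidEntropy _ _)⟩
  · rintro ⟨Ω, _, p, hp, A, X, hX⟩
    exact ⟨Ω, _, p, hp, A, X, fun T => (hX T).trans (shannonEntropy_eq_setoidEntropy _ _).symm⟩

theorem jointKer_union {Ω : Type*} {A : E → Type*} (X : (i : E) → Ω → A i) (S T : Set E) :
    jointKer X (S ∪ T) = jointKer X S ⊓ jointKer X T := by
  ext a b
  rw [Setoid.inf_def]
  simp only [jointKer_iff, Pi.inf_apply, inf_Prop_eq, Set.mem_union]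
  exact ⟨fun h => ⟨fun i hi => h i (.inl hi), fun i hi => h i (.inr hi)⟩,
    fun h i hi => hi.elim (h.1 i) (h.2 i)⟩

theorem jointKer_anti {Ω : Type*} {A : E → Type*} (X : (i : E) → Ω → A i) {S T : Set E}
    (h : S ⊆ T) : jointKer X T ≤ jointKer X S := by
  intro a b hab
  rw [jointKer_iff] at hab ⊢
  exact fun i hi => hab i (h hi)

theorem IsEntropic.isPolymatroid {h : Set E → ℝ} (hh : IsEntropic h) : IsPolymatroid h := by
  obtain ⟨Ω, _, p, hp, A, X, hX⟩ := isEntropic_iff.mp hh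
  refine ⟨?_, fun S T hST => ?_, fun S T => ?_⟩
  · rw [hX, ← setoidEntropy_top hp]
    congr 1
    ext a b
    simp [jointKer_iff, Setoid.top_def]
  · rw [hX, hX]
    exact setoidEntropy_anti hp.1 (jointKer_anti X hST)
  · rw [hX, hX, hX, hX, jointKer_union]
    exact setoidEntropy_submodular hp (jointKer_anti X Set.inter_subset_left)
      (jointKer_anti X Set.inter_subset_right)

/-- Replacing the variables outside `G` by constants. -/
theorem IsEntropic.inter {h : Set E → ℝ} (hh : IsEntropic h) (G : Set E) :
    IsEntropic fun T => h (T ∩ G) := by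
  classical
  obtain ⟨Ω, _, p, hp, A, X, hX⟩ := isEntropic_iff.mp hh
  refine isEntropic_iff.mpr ⟨Ω, inferInstance, p, hp, fun i => Option (A i),
    fun i ω => if i ∈ G then some (X i ω) else none, fun T => ?_⟩
  rw [hX]
  congr 1
  ext a b
  simp only [jointKer_iff, Set.mem_inter_iff]
  refine forall_congr' fun i => ?_
  by_cases hi : i ∈ G <;> simp [hi]

/-- The variable at `j` bundles all the variables in the fibre over `j`. It is constant if the fibre
is empty, so elements outside the range become loops. -/
theorem IsEntropic.preimage {E' : Type*} {h : Set E → ℝ} (hh : IsEntropic h) (ι : E → E') :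
    IsEntropic fun T : Set E' => h (ι ⁻¹' T) := by
  obtain ⟨Ω, _, p, hp, A, X, hX⟩ := isEntropic_iff.mp hh
  refine isEntropic_iff.mpr ⟨Ω, inferInstance, p, hp,
    fun j => Quotient (jointKer X {i | ι i = j}), fun j ω => ⟦ω⟧, fun T => ?_⟩
  rw [hX]
  congr 1
  ext a b
  simp only [jointKer_iff, Quotient.eq]
  exact ⟨fun H j hj i hi => H i (by rw [← hi] at hj; exact hj), fun H i hi => H (ι i) hi i rfl⟩

end Entropic

end

noncomputable section

open Finset Filter Topology

/-! ## Entropic functions of families of subgroups -/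

section Subgroups

variable {E : Type*}

/-- The logarithm of the index of the intersection of the subgroups `K i`, for `i ∈ T`. -/
def subgroupRank {Γ : Type*} [Group Γ] (K : E → Subgroup Γ) (T : Set E) : ℝ :=
  Real.logb 2 ((⨅ i ∈ T, K i).index : ℝ)

theorem uniform_mem_stdSimplex (Γ : Type*) [Fintype Γ] [Nonempty Γ] :
    (fun _ : Γ => (1 : ℝ) / Fintype.card Γ) ∈ stdSimplex ℝ Γ := by
  refine ⟨fun _ => by positivity, ?_⟩
  simp

theorem classMass_uniform_leftRel {Γ : Type*} [Fintype Γ] [Group Γ] (K : Subgroup Γ) (g : Γ) :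
    classMass (fun _ : Γ => (1 : ℝ) / Fintype.card Γ) (QuotientGroup.leftRel K) g =
      1 / (K.index : ℝ) := by
  classical
  unfold classMass
  rw [Finset.sum_const, nsmul_eq_mul]
  have h1 : (univ.filter fun a => QuotientGroup.leftRel K a g).card = Nat.card K := by
    rw [Nat.card_eq_fintype_card, ← Finset.card_univ (α := K)]
    symm
    refine Finset.card_bij (fun k _ => g * (k : Γ)) ?_ ?_ ?_
    · intro k _
      simp [QuotientGroup.leftRel_apply]
    · intro k _ k' _ h
      exact Subtype.ext (mul_left_cancel h)
    · intro a ha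
      simp only [mem_filter, mem_univ, true_and, QuotientGroup.leftRel_apply] at ha
      exact ⟨⟨g⁻¹ * a, by simpa using K.inv_mem ha⟩, by simp, by simp⟩
  have h2 := K.card_mul_index
  have h4 : (Nat.card K : ℝ) = (univ.filter fun a => QuotientGroup.leftRel K a g).card := by
    rw [h1]
  trans (Nat.card K : ℝ) * (1 / Fintype.card Γ)
  · rw [h4]
    congr!
  rw [← Nat.card_eq_fintype_card, ← h2]
  have h3 : (Nat.card K : ℝ) ≠ 0 := by exact_mod_cast Nat.card_pos.ne'
  push_cast
  field_simp

theorem setoidEntropy_uniform_leftRel {Γ : Type*} [Fintype Γ] [Group Γ] (K : Subgroup Γ) :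
    setoidEntropy (fun _ : Γ => (1 : ℝ) / Fintype.card Γ) (QuotientGroup.leftRel K) =
      Real.logb 2 K.index := by
  unfold setoidEntropy
  simp only [classMass_uniform_leftRel, one_div_one_div]
  rw [← Finset.sum_mul, (uniform_mem_stdSimplex Γ).2, one_mul]

theorem jointKer_leftCosets {Γ : Type*} [Group Γ] (K : E → Subgroup Γ) (T : Set E) :
    jointKer (fun i (g : Γ) => (g : Γ ⧸ K i)) T = QuotientGroup.leftRel (⨅ i ∈ T, K i) := by
  ext a b
  simp [jointKer_iff, QuotientGroup.leftRel_apply, Subgroup.mem_iInf, QuotientGroup.eq]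

theorem isEntropic_subgroupRank {Γ : Type} [Finite Γ] [Group Γ] (K : E → Subgroup Γ) :
    IsEntropic (subgroupRank K) := by
  have := Fintype.ofFinite Γ
  refine isEntropic_iff.mpr ⟨Γ, inferInstance, _, uniform_mem_stdSimplex Γ, fun i => Γ ⧸ K i,
    fun i g => (g : Γ ⧸ K i), fun T => ?_⟩
  rw [jointKer_leftCosets, setoidEntropy_uniform_leftRel, subgroupRank]

end Subgroups

/-! ## Asymptotics of factorials -/

theorem log_factorial_lower (n : ℕ) : n * Real.log n - n ≤ Real.log (n.factorial : ℝ) := by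
  induction n with
  | zero => simp
  | succ n ih =>
    rw [Nat.factorial_succ, Nat.cast_mul, Real.log_mul (by positivity) (by positivity)]
    rcases Nat.eq_zero_or_pos n with rfl | hn
    · simp
    · have hn' : (0 : ℝ) < n := by exact_mod_cast hn
      have h := Real.log_le_sub_one_of_pos (x := ((n : ℝ) + 1) / n) (by positivity)
      rw [Real.log_div (by positivity) (by positivity)] at h
      have h2 : n * (Real.log (n + 1) - Real.log n) ≤ 1 := by
        have := mul_le_mul_of_nonneg_left h hn'.le
        have h3 : (n : ℝ) * (((n : ℝ) + 1) / n - 1) = 1 := by field_simp; ring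
        linarith
      push_cast
      linarith

theorem log_factorial_upper (n : ℕ) (hn : n ≠ 0) :
    Real.log (n.factorial : ℝ) ≤ n * Real.log n - n + 1 + Real.log n := by
  induction n with
  | zero => exact absurd rfl hn
  | succ n ih =>
    rcases Nat.eq_zero_or_pos n with rfl | hn
    · simp
    · have ih := ih hn.ne'
      have hn' : (0 : ℝ) < n := by exact_mod_cast hn
      rw [Nat.factorial_succ, Nat.cast_mul, Real.log_mul (by positivity) (by positivity)]
      have h := Real.log_le_sub_one_of_pos (x := n / ((n : ℝ) + 1)) (by positivity)
      rw [Real.log_div (by positivity) (by positivity)] at h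
      have h2 : ((n : ℝ) + 1) * (Real.log n - Real.log (n + 1)) ≤ -1 := by
        have := mul_le_mul_of_nonneg_left h (by positivity : (0 : ℝ) ≤ n + 1)
        have h3 : ((n : ℝ) + 1) * (n / ((n : ℝ) + 1) - 1) = -1 := by field_simp; ring
        linarith
      push_cast
      linarith

/-- A weak Stirling formula with the term `a N * log N` removed. These terms cancel in a multinomial
coefficient, leaving an entropy. -/
theorem tendsto_log_factorial_div {a : ℕ → ℕ} {x : ℝ}
    (ha : Tendsto (fun N => (a N : ℝ) / N) atTop (𝓝 x)) :
    Tendsto (fun N => (Real.log ((a N).factorial : ℝ) - a N * Real.log N) / N) atTop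
      (𝓝 (x * Real.log x - x)) := by
  have hmain : Tendsto (fun N => ((a N : ℝ) / N) * Real.log ((a N : ℝ) / N) - (a N : ℝ) / N) atTop
      (𝓝 (x * Real.log x - x)) :=
    ((Real.continuous_mul_log.tendsto x).comp ha).sub ha
  have herr : Tendsto (fun N : ℕ => (Real.log ((a N).factorial : ℝ) -
      (a N * Real.log (a N) - a N)) / N) atTop (𝓝 0) := by
    have hup : Tendsto (fun N : ℕ => 2 * √((a N : ℝ) / N) * (√(N : ℝ))⁻¹) atTop (𝓝 0) := by
      have h1 : Tendsto (fun N : ℕ => (√(N : ℝ))⁻¹) atTop (𝓝 0) :=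
        (Real.tendsto_sqrt_atTop.comp tendsto_natCast_atTop_atTop).inv_tendsto_atTop
      simpa using ((ha.sqrt).const_mul 2).mul h1
    refine tendsto_of_tendsto_of_tendsto_of_le_of_le tendsto_const_nhds hup (fun N => ?_)
      (fun N => ?_)
    · have := log_factorial_lower (a N)
      exact div_nonneg (by linarith) (by positivity)
    -- The Stirling error `1 + log a` is at most `2 * √a`, by `log x ≤ x - 1` at `x = √a`.
    · have h1 : Real.log ((a N).factorial : ℝ) - (a N * Real.log (a N) - a N) ≤ 2 * √(a N) := by
        rcases eq_or_ne (a N) 0 with h0 | h0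
        · simp [h0]
        · have := log_factorial_upper (a N) h0
          have hpos : (0 : ℝ) < a N := by exact_mod_cast Nat.pos_of_ne_zero h0
          have h3 := Real.log_le_sub_one_of_pos (Real.sqrt_pos.mpr hpos)
          rw [Real.log_sqrt hpos.le] at h3
          linarith
      have h2 : 2 * √((a N : ℝ) / N) * (√(N : ℝ))⁻¹ = 2 * √(a N) / N := by
        rw [Real.sqrt_div (by positivity), div_eq_mul_inv, mul_assoc, mul_assoc, ← mul_inv,
          Real.mul_self_sqrt (by positivity)]
        ring
      rw [h2]
      exact div_le_div_of_nonneg_right h1 (by positivity)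
  have := hmain.add herr
  rw [add_zero] at this
  refine this.congr' ?_
  filter_upwards [eventually_gt_atTop 0] with N hN
  have hN' : (N : ℝ) ≠ 0 := by exact_mod_cast hN.ne'
  rcases eq_or_ne (a N) 0 with h0 | h0
  · simp [h0]
  · have h0' : (a N : ℝ) ≠ 0 := by exact_mod_cast h0
    rw [Real.log_div h0' hN']
    field_simp
    ring

/-! ## Entropic functions are limits of normalized functions of families of subgroups -/

section TypeClass

variable {Ω : Type*} [Fintype Ω]

/-- The permutations of `Σ ω, Fin (m ω)` which preserve the `R`-class of the first component. -/
def fiberStabilizer (m : Ω → ℕ) (R : Setoid Ω) : Subgroup (Equiv.Perm (Σ ω, Fin (m ω))) where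
  carrier := {σ | ∀ j, R (σ j).1 j.1}
  mul_mem' := fun {σ τ} hσ hτ j => R.trans (hσ (τ j)) (hτ j)
  one_mem' := fun _ => R.refl _
  inv_mem' := fun {σ} hσ j => R.symm (by simpa using hσ (σ⁻¹ j))

omit [Fintype Ω] in
theorem mem_fiberStabilizer {m : Ω → ℕ} {R : Setoid Ω} {σ : Equiv.Perm (Σ ω, Fin (m ω))} :
    σ ∈ fiberStabilizer m R ↔ ∀ j, R (σ j).1 j.1 := Iff.rfl

open Classical in
-- The stabilizer is a product of symmetric groups, one for each class, so its index is a
-- multinomial coefficient.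
theorem card_fiberStabilizer (m : Ω → ℕ) (R : Setoid Ω) :
    Nat.card (fiberStabilizer m R) =
      ∏ x : Quotient R, (∑ ω with (⟦ω⟧ : Quotient R) = x, m ω).factorial := by
  have h := DomMulAct.stabilizer_card fun j : (Σ ω, Fin (m ω)) => (⟦j.1⟧ : Quotient R)
  have h1 : Nat.card (fiberStabilizer m R) = Fintype.card {g : Equiv.Perm (Σ ω, Fin (m ω)) //
      (fun j : (Σ ω, Fin (m ω)) => (⟦j.1⟧ : Quotient R)) ∘ g = fun j => ⟦j.1⟧} := by
    rw [← Nat.card_eq_fintype_card]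
    refine Nat.card_congr (Equiv.subtypeEquivRight fun g => ?_)
    simp only [mem_fiberStabilizer, funext_iff, Function.comp, Quotient.eq]
  rw [h1, h]
  refine Finset.prod_congr rfl fun x _ => ?_
  congr 1
  rw [Fintype.card_subtype, Finset.card_filter, Fintype.sum_sigma, Finset.sum_filter]
  refine Finset.sum_congr rfl fun ω _ => ?_
  by_cases hω : (⟦ω⟧ : Quotient R) = x <;> simp [hω]

omit [Fintype Ω] in
theorem iInf_fiberStabilizer_ker {E : Type*} (m : Ω → ℕ) {A : E → Type*}
    (X : (i : E) → Ω → A i) (T : Set E) :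
    ⨅ i ∈ T, fiberStabilizer m (Setoid.ker (X i)) = fiberStabilizer m (jointKer X T) := by
  ext σ
  simp only [Subgroup.mem_iInf, mem_fiberStabilizer, jointKer_iff, Setoid.ker_def]
  exact ⟨fun h j i hi => h i hi j, fun h i hi j => h j i hi⟩

open Classical in
theorem setoidEntropy_eq_sum_quotient (p : Ω → ℝ) (R : Setoid Ω) :
    setoidEntropy p R = -(∑ x : Quotient R, (∑ ω with (⟦ω⟧ : Quotient R) = x, p ω) *
      Real.log (∑ ω with (⟦ω⟧ : Quotient R) = x, p ω)) / Real.log 2 := by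
  unfold setoidEntropy
  rw [← Finset.sum_fiberwise (s := univ) (g := fun ω => (⟦ω⟧ : Quotient R)), neg_div,
    Finset.sum_div, ← Finset.sum_neg_distrib]
  refine Finset.sum_congr rfl fun x _ => ?_
  rw [Finset.sum_mul, Finset.sum_div, ← Finset.sum_neg_distrib]
  refine Finset.sum_congr rfl fun ω hω => ?_
  simp only [mem_filter, mem_univ, true_and] at hω
  have : classMass p R ω = ∑ ω with (⟦ω⟧ : Quotient R) = x, p ω := by
    unfold classMass
    congr 1
    ext α
    simp only [mem_filter, mem_univ, true_and, ← hω, Quotient.eq]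
  rw [this, one_div, Real.logb_inv, Real.logb]
  ring

/-- The index counts the sequences of a given type. Its logarithm is a difference of log-factorials
with equal total argument, so the `log N` terms cancel and the entropy remains. -/
theorem tendsto_logb_index_fiberStabilizer {p : Ω → ℝ} (hp : p ∈ stdSimplex ℝ Ω)
    {m : ℕ → Ω → ℕ} (hm : ∀ ω, Tendsto (fun N => (m N ω : ℝ) / N) atTop (𝓝 (p ω)))
    (R : Setoid Ω) :
    Tendsto (fun N => Real.logb 2 ((fiberStabilizer (m N) R).index : ℝ) / N) atTop
      (𝓝 (setoidEntropy p R)) := by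
  classical
  set M : ℕ → Quotient R → ℕ := fun N x => ∑ ω with (⟦ω⟧ : Quotient R) = x, m N ω with hM
  set P : Quotient R → ℝ := fun x => ∑ ω with (⟦ω⟧ : Quotient R) = x, p ω with hP
  have hMP : ∀ x, Tendsto (fun N => (M N x : ℝ) / N) atTop (𝓝 (P x)) := by
    intro x
    simp only [hM, hP, Nat.cast_sum, Finset.sum_div]
    exact tendsto_finsetSum _ fun ω _ => hm ω
  have hsum : ∀ N, ∑ x, M N x = ∑ ω, m N ω := fun N => Finset.sum_fiberwise _ _ _
  have hPsum : ∑ x, P x = 1 := by rw [← hp.2]; exact Finset.sum_fiberwise _ _ _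
  have htot : Tendsto (fun N => ((∑ ω, m N ω : ℕ) : ℝ) / N) atTop (𝓝 1) := by
    rw [← hp.2]
    simp only [Nat.cast_sum, Finset.sum_div]
    exact tendsto_finsetSum _ fun ω _ => hm ω
  have hidx : ∀ N, Real.log ((fiberStabilizer (m N) R).index : ℝ) =
      Real.log ((∑ ω, m N ω).factorial : ℝ) - ∑ x, Real.log ((M N x).factorial : ℝ) := by
    intro N
    have h1 := (fiberStabilizer (m N) R).card_mul_index
    rw [card_fiberStabilizer, Nat.card_eq_fintype_card, Fintype.card_perm, Fintype.card_sigma]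
      at h1
    simp only [Fintype.card_fin] at h1
    rw [← h1, Nat.cast_mul, Real.log_mul, Nat.cast_prod, Real.log_prod]
    · ring
    · intro x _
      exact_mod_cast (Nat.factorial_pos _).ne'
    · exact_mod_cast (Finset.prod_pos fun x _ => Nat.factorial_pos _).ne'
    · exact_mod_cast Subgroup.index_ne_zero_of_finite
  have h2 := (tendsto_log_factorial_div htot).sub
    (tendsto_finsetSum univ fun x _ => tendsto_log_factorial_div (hMP x))
  have h3 := h2.div_const (Real.log 2)
  have hlim : setoidEntropy p R =
      (1 * Real.log 1 - 1 - ∑ x, (P x * Real.log (P x) - P x)) / Real.log 2 := by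
    rw [setoidEntropy_eq_sum_quotient, Finset.sum_sub_distrib, hPsum, Real.log_one]
    congr 1
    ring
  rw [hlim]
  refine h3.congr fun N => ?_
  rw [Real.logb, hidx, ← Finset.sum_div, Finset.sum_sub_distrib, ← Finset.sum_mul, ← hsum,
    Nat.cast_sum]
  ring

end TypeClass

/-- Every entropic function is the limit of the normalized functions of families of subgroups
of finite groups. -/
theorem IsEntropic.exists_subgroups {E : Type*} {h : Set E → ℝ} (hh : IsEntropic h) :
    ∃ (Γ : ℕ → Type) (_ : ∀ N, Group (Γ N)) (_ : ∀ N, Finite (Γ N))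
      (K : (N : ℕ) → E → Subgroup (Γ N)),
      ∀ T, Tendsto (fun N : ℕ => subgroupRank (K N) T / N) atTop (𝓝 (h T)) := by
  obtain ⟨Ω, _, p, hp, A, X, hX⟩ := isEntropic_iff.mp hh
  -- The outcome `ω` is repeated about `p ω * N` times. The floors need not add up to `N`; only the
  -- limiting frequencies matter.
  refine ⟨fun N => Equiv.Perm (Σ ω, Fin ⌊p ω * N⌋₊), inferInstance, inferInstance,
    fun N i => fiberStabilizer _ (Setoid.ker (X i)), fun T => ?_⟩
  simp only [subgroupRank, iInf_fiberStabilizer_ker, hX]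
  exact tendsto_logb_index_fiberStabilizer hp (m := fun N ω => ⌊p ω * N⌋₊) (fun ω =>
    (tendsto_nat_floor_mul_div_atTop (hp.1 ω)).comp tendsto_natCast_atTop_atTop) _

end

noncomputable section

open Finset Filter Topology

/-! ## Scaling of entropic functions -/

/-- The entropy of a variable that is observed with probability `δ` only. -/
theorem IsEntropic.erasure {E : Type*} {h : Set E → ℝ} (hh : IsEntropic h) {δ : ℝ}
    (h0 : 0 < δ) (h1 : δ < 1) : ∃ g : Set E → ℝ, IsEntropic g ∧ g ∅ = 0 ∧
      ∀ T : Set E, T.Nonempty →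
        g T = δ * h T + ((1 - δ) * Real.logb 2 (1 / (1 - δ)) + δ * Real.logb 2 (1 / δ)) := by
  classical
  obtain ⟨Ω, _, p, hp, A, X, hX⟩ := isEntropic_iff.mp hh
  have hq : (fun o : Option Ω => o.elim (1 - δ) fun ω => δ * p ω) ∈ stdSimplex ℝ (Option Ω) := by
    refine ⟨fun o => ?_, ?_⟩
    · rcases o with _ | ω
      · simpa using h1.le
      · exact mul_nonneg h0.le (hp.1 ω)
    · rw [Fintype.sum_option]
      simp only [Option.elim_none, Option.elim_some]
      rw [← Finset.mul_sum, hp.2]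
      ring
  set q : Option Ω → ℝ := fun o => o.elim (1 - δ) fun ω => δ * p ω with hqdef
  -- One common event erases all the variables at once. Any nonempty subfamily therefore reveals
  -- whether erasure occurred, which accounts for the binary entropy term.
  set Y : (i : E) → Option Ω → Option (A i) := fun i o => o.map (X i) with hY
  have hent : IsEntropic fun T => setoidEntropy q (jointKer Y T) :=
    isEntropic_iff.mpr ⟨Option Ω, inferInstance, q, hq, fun i => Option (A i), Y, fun T => rfl⟩
  refine ⟨_, hent, hent.isPolymatroid.map_empty, fun T hT => ?_⟩
  obtain ⟨i₀, hi₀⟩ := hT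
  have hnone : classMass q (jointKer Y T) none = 1 - δ := by
    unfold classMass
    rw [Finset.sum_eq_single none]
    · rfl
    · rintro (_ | ω) hω hne
      · exact absurd rfl hne
      · simp only [mem_filter, mem_univ, true_and, jointKer_iff, hY] at hω
        simpa using hω i₀ hi₀
    · intro h
      simp at h
  have hsome : ∀ ω, classMass q (jointKer Y T) (some ω) = δ * classMass p (jointKer X T) ω := by
    intro ω
    unfold classMass
    rw [Finset.sum_filter, Fintype.sum_option, if_neg, zero_add, Finset.mul_sum,
      Finset.sum_filter]
    · refine Finset.sum_congr rfl fun α _ => ?_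
      simp only [jointKer_iff, hY, Option.map_some, Option.some_inj]
      rfl
    · intro hcon
      rw [jointKer_iff] at hcon
      simpa [hY] using hcon i₀ hi₀
  rw [hX]
  unfold setoidEntropy
  rw [Fintype.sum_option, hnone]
  have : ∀ ω, q (some ω) * Real.logb 2 (1 / classMass q (jointKer Y T) (some ω)) =
      δ * (p ω * Real.logb 2 (1 / classMass p (jointKer X T) ω)) +
        p ω * (δ * Real.logb 2 (1 / δ)) := by
    intro ω
    rw [hsome]
    simp only [hqdef, Option.elim_some]
    rcases (hp.1 ω).eq_or_lt with hω | hω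
    · simp [← hω]
    · have h2 := (hω.trans_le (le_classMass hp.1 (jointKer X T) ω)).ne'
      simp only [one_div, Real.logb_inv]
      rw [Real.logb_mul h0.ne' h2]
      ring
  rw [Finset.sum_congr rfl fun ω _ => this ω, Finset.sum_add_distrib, ← Finset.mul_sum,
    ← Finset.sum_mul, hp.2]
  simp only [hqdef, Option.elim_none]
  ring

theorem tendsto_binary_entropy_zero :
    Tendsto (fun δ : ℝ => (1 - δ) * Real.logb 2 (1 / (1 - δ)) + δ * Real.logb 2 (1 / δ)) (𝓝 0)
      (𝓝 0) := by
  have h1 : Continuous fun δ : ℝ => -((1 - δ) * Real.log (1 - δ)) / Real.log 2 +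
      -(δ * Real.log δ) / Real.log 2 :=
    (((Real.continuous_mul_log.comp (continuous_const.sub continuous_id)).neg).div_const _).add
      (Real.continuous_mul_log.neg.div_const _)
  have h2 := h1.tendsto 0
  simp only [sub_zero, Real.log_one, Real.log_zero, mul_zero, neg_zero, zero_div, add_zero] at h2
  refine h2.congr fun δ => ?_
  simp only [one_div, Real.logb, Real.log_inv]
  ring

/-- The entropic functions scaled down by a natural number are limits of entropic functions. -/
theorem IsEntropic.exists_tendsto_div {E : Type*} {h : Set E → ℝ} (hh : IsEntropic h) {n : ℕ}
    (hn : 0 < n) : ∃ g : ℕ → Set E → ℝ, (∀ k, IsEntropic (g k)) ∧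
      ∀ T, Tendsto (fun k => g k T) atTop (𝓝 (h T / n)) := by
  obtain ⟨Γ, _, _, K, hK⟩ := hh.exists_subgroups
  -- The group approximation at level `k + 2` is observed with probability `1 / (n * (k + 2))`, so
  -- normalization and division by `n` happen together. The shift by 2 keeps `δ < 1` when `n = 1`.
  set δ : ℕ → ℝ := fun k => 1 / ((n : ℝ) * (k + 2 : ℕ)) with hδ
  have hn1 : (1 : ℝ) ≤ n := by exact_mod_cast hn
  have hδ0 : ∀ k, 0 < δ k := fun k => by positivity
  have hδ1 : ∀ k, δ k < 1 := fun k => by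
    simp only [hδ]
    rw [div_lt_one (by positivity)]
    push_cast
    have : (0 : ℝ) ≤ k := by positivity
    nlinarith
  have hlim : Tendsto δ atTop (𝓝 0) := by
    have h1 : Tendsto (fun k : ℕ => (n : ℝ) * ((k + 2 : ℕ) : ℝ)) atTop atTop :=
      (tendsto_natCast_atTop_atTop.comp (tendsto_add_atTop_nat 2)).const_mul_atTop (by positivity)
    exact h1.inv_tendsto_atTop.congr fun k => (one_div _).symm
  choose g hg hg0 hgT using fun k =>
    (isEntropic_subgroupRank (K (k + 2))).erasure (hδ0 k) (hδ1 k)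
  refine ⟨g, hg, fun T => ?_⟩
  rcases T.eq_empty_or_nonempty with rfl | hT
  · simp [hg0, hh.isPolymatroid.map_empty]
  · have h1 : Tendsto (fun k => δ k * subgroupRank (K (k + 2)) T) atTop (𝓝 (h T / n)) := by
      refine (((hK T).comp (tendsto_add_atTop_nat 2)).div_const (n : ℝ)).congr fun k => ?_
      simp only [Function.comp, hδ]
      field_simp
    have h2 := h1.add (tendsto_binary_entropy_zero.comp hlim)
    rw [add_zero] at h2
    exact h2.congr fun k => (hgT k T hT).symm

end

noncomputable section

open Finset Filter Topology Pointwise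

/-! ## Covering a finite group by translates -/

section Covering

variable {Γ : Type*} [Group Γ] [Fintype Γ] [DecidableEq Γ]

/-- Averaging over `c`: each `g` lies in exactly `P.card` of the translates of `P`. -/
theorem exists_translate_card_inter_ge (P U : Finset Γ) :
    ∃ c : Γ, (P.card : ℝ) * U.card / Fintype.card Γ ≤ (U.filter fun g => c⁻¹ * g ∈ P).card := by
  by_contra! hcon
  have hΓ : (0 : ℝ) < Fintype.card Γ := by exact_mod_cast Fintype.card_pos
  have h1 : ∑ c : Γ, ((U.filter fun g => c⁻¹ * g ∈ P).card : ℝ) < (P.card : ℝ) * U.card := by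
    calc _ < ∑ c : Γ, (P.card : ℝ) * U.card / Fintype.card Γ :=
          Finset.sum_lt_sum_of_nonempty univ_nonempty fun c _ => hcon c
      _ = _ := by
          rw [Finset.sum_const, nsmul_eq_mul, Finset.card_univ]
          field_simp
  have h2 : ∑ c : Γ, (U.filter fun g => c⁻¹ * g ∈ P).card = P.card * U.card := by
    simp_rw [Finset.card_filter]
    rw [Finset.sum_comm, mul_comm, ← smul_eq_mul, ← Finset.sum_const]
    refine Finset.sum_congr rfl fun g _ => ?_
    rw [← Finset.card_filter]
    refine Finset.card_bij (fun c _ => c⁻¹ * g) (fun c hc => by simpa using hc) ?_ ?_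
    · intro c _ c' _ h
      simpa using h
    · intro x hx
      exact ⟨g * x⁻¹, by simpa using hx, by simp⟩
  rw [← Nat.cast_sum, h2] at h1
  push_cast at h1
  exact lt_irrefl _ h1

/-- Greedy choice: each new translate removes at least the proportion `|P| / |Γ|` of what is still
uncovered. -/
theorem exists_translates_card_compl_le (P : Finset Γ) (k : ℕ) :
    ∃ C : Finset Γ, C.card ≤ k ∧ ((univ.filter fun g => ∀ c ∈ C, c⁻¹ * g ∉ P).card : ℝ) ≤
      Fintype.card Γ * (1 - P.card / Fintype.card Γ) ^ k := by
  have hΓ : (0 : ℝ) < Fintype.card Γ := by exact_mod_cast Fintype.card_pos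
  induction k with
  | zero => exact ⟨∅, by simp, by simp⟩
  | succ k ih =>
    obtain ⟨C, hC, hU⟩ := ih
    set U := univ.filter fun g => ∀ c ∈ C, c⁻¹ * g ∉ P with hUdef
    obtain ⟨c, hc⟩ := exists_translate_card_inter_ge P U
    refine ⟨insert c C, (Finset.card_insert_le _ _).trans (by omega), ?_⟩
    have h1 : (univ.filter fun g => ∀ c' ∈ insert c C, c'⁻¹ * g ∉ P) =
        U.filter fun g => c⁻¹ * g ∉ P := by
      ext g
      simp only [hUdef, mem_filter, mem_univ, true_and, mem_insert, forall_eq_or_imp]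
      tauto
    have h2 := Finset.card_filter_add_card_filter_not (s := U) (fun g => c⁻¹ * g ∈ P)
    have h3 : ((U.filter fun g => c⁻¹ * g ∈ P).card : ℝ) +
      (U.filter fun g => c⁻¹ * g ∉ P).card = U.card := by exact_mod_cast h2
    rw [h1, pow_succ]
    have hP : (P.card : ℝ) / Fintype.card Γ ≤ 1 := by
      rw [div_le_one hΓ]
      exact_mod_cast Finset.card_le_univ P
    calc ((U.filter fun g => c⁻¹ * g ∉ P).card : ℝ)
        ≤ U.card - P.card * U.card / Fintype.card Γ := by linarith
      _ = U.card * (1 - P.card / Fintype.card Γ) := by ring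
      _ ≤ (Fintype.card Γ * (1 - P.card / Fintype.card Γ) ^ k) * (1 - P.card / Fintype.card Γ) :=
          mul_le_mul_of_nonneg_right hU (by linarith)
      _ = _ := by ring

/-- A union `P` of left cosets of `H` has few translates covering the group. -/
theorem exists_translates_cover (P : Finset Γ) (hP : P.Nonempty) (H : Subgroup Γ)
    (hPH : ∀ g ∈ P, ∀ h ∈ H, g * h ∈ P) :
    ∃ C : Finset Γ, (∀ g, ∃ c ∈ C, c⁻¹ * g ∈ P) ∧
      (C.card : ℝ) ≤ Fintype.card Γ / P.card * (Real.log H.index + 1) := by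
  have hΓ : (0 : ℝ) < Fintype.card Γ := by exact_mod_cast Fintype.card_pos
  have hP0 : (0 : ℝ) < P.card := by exact_mod_cast hP.card_pos
  have hPΓ : (P.card : ℝ) ≤ Fintype.card Γ := by exact_mod_cast Finset.card_le_univ P
  have hi1 : (1 : ℝ) ≤ H.index := by
    exact_mod_cast Nat.one_le_iff_ne_zero.mpr Subgroup.index_ne_zero_of_finite
  set r : ℝ := Fintype.card Γ / P.card with hr
  have hr1 : 1 ≤ r := by rw [hr, le_div_iff₀ hP0]; linarith
  have hlog : 0 ≤ Real.log H.index := Real.log_nonneg hi1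
  -- After this many steps fewer than `|Γ| / [Γ : H] = |H|` elements remain uncovered. The uncovered
  -- set is a union of left cosets of `H`, hence empty. The overhead thus depends on the index of
  -- `H` and not on the order of `Γ`.
  set k := ⌊r * Real.log H.index⌋₊ + 1 with hk
  obtain ⟨C, hC, hU⟩ := exists_translates_card_compl_le P k
  refine ⟨C, ?_, ?_⟩
  · by_contra! hcon
    obtain ⟨g, hg⟩ := hcon
    have h1 : Nat.card H ≤ (univ.filter fun g => ∀ c ∈ C, c⁻¹ * g ∉ P).card := by
      have := Fintype.ofFinite H
      rw [Nat.card_eq_fintype_card, ← Finset.card_univ (α := H)]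
      refine Finset.card_le_card_of_injOn (fun h => g * (h : Γ)) (fun h _ => ?_) ?_
      · simp only [coe_filter, mem_univ, true_and, Set.mem_ofPred_eq]
        intro c hc hmem
        exact hg c hc (by simpa [mul_assoc] using hPH _ hmem _ (H.inv_mem h.2))
      · intro h _ h' _ heq
        exact Subtype.ext (mul_left_cancel heq)
    have h2 : (Fintype.card Γ : ℝ) * (1 - P.card / Fintype.card Γ) ^ k < Nat.card H := by
      have h3 : (1 - (P.card : ℝ) / Fintype.card Γ) ^ k ≤ Real.exp (-(k / r)) := by
        have h4 : 1 - (P.card : ℝ) / Fintype.card Γ ≤ Real.exp (-(1 / r)) := by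
          have := Real.add_one_le_exp (-(1 / r))
          have h5 : 1 / r = P.card / Fintype.card Γ := by rw [hr, one_div_div]
          linarith
        have h6 : 0 ≤ 1 - (P.card : ℝ) / Fintype.card Γ := by
          rw [sub_nonneg, div_le_one hΓ]
          exact hPΓ
        calc _ ≤ (Real.exp (-(1 / r))) ^ k := pow_le_pow_left₀ h6 h4 k
          _ = _ := by rw [← Real.exp_nat_mul]; congr 1; ring
      have h7 : Real.exp (-(k / r)) < 1 / H.index := by
        rw [Real.exp_neg, one_div]
        apply inv_strictAnti₀ (by positivity)
        rw [← Real.log_lt_iff_lt_exp (by positivity), lt_div_iff₀ (by positivity), mul_comm]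
        exact_mod_cast Nat.lt_floor_add_one _
      have h8 : (Nat.card H : ℝ) = Fintype.card Γ * (1 / H.index) := by
        have := H.card_mul_index
        rw [← Nat.card_eq_fintype_card, ← this]
        push_cast
        field_simp
      rw [h8]
      exact mul_lt_mul_of_pos_left (h3.trans_lt h7) hΓ
    have h3 : (Nat.card H : ℝ) ≤ _ := (by exact_mod_cast h1 : (Nat.card H : ℝ) ≤
      ((univ.filter fun g => ∀ c ∈ C, c⁻¹ * g ∉ P).card : ℝ)).trans hU
    linarith
  · calc (C.card : ℝ) ≤ k := by exact_mod_cast hC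
      _ ≤ r * Real.log H.index + 1 := by
          rw [hk]
          push_cast
          linarith [Nat.floor_le (by positivity : 0 ≤ r * Real.log H.index)]
      _ ≤ r * (Real.log H.index + 1) := by linarith

end Covering

theorem Subgroup.card_mul_eq_card_mul_relIndex {Γ : Type*} [Group Γ] (H K : Subgroup Γ) :
    Nat.card (↑((K : Set Γ) * (H : Set Γ)) : Type _) = Nat.card H * H.relIndex K := by
  rw [Subgroup.card_mul_eq_card_subgroup_mul_card_quotient]
  congr 1
  have hs : ∀ k : K, k • ((1 : Γ) : Γ ⧸ H) = ((k : Γ) : Γ ⧸ H) := fun k => by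
    change (((k : Γ) * 1 : Γ) : Γ ⧸ H) = _
    rw [mul_one]
  have h1 : MulAction.stabilizer K ((1 : Γ) : Γ ⧸ H) = H.subgroupOf K := by
    ext k
    rw [MulAction.mem_stabilizer_iff, Subgroup.mem_subgroupOf, hs, eq_comm, QuotientGroup.eq]
    simp
  have h2 := MulAction.index_stabilizer K ((1 : Γ) : Γ ⧸ H)
  rw [h1] at h2
  rw [Subgroup.relIndex, h2, Nat.card_coe_set_eq]
  congr 1
  ext x
  simp only [Set.mem_image, MulAction.mem_orbit_iff, hs, SetLike.mem_coe]
  constructor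
  · rintro ⟨k, hk, rfl⟩
    exact ⟨⟨k, hk⟩, rfl⟩
  · rintro ⟨k, rfl⟩
    exact ⟨k, k.2, rfl⟩

theorem logb_relIndex {Γ : Type*} [Group Γ] [Finite Γ] (H K : Subgroup Γ) :
    Real.logb 2 (H.relIndex K) = Real.logb 2 (H ⊓ K).index - Real.logb 2 K.index := by
  have h1 := Subgroup.relIndex_mul_index (H := H ⊓ K) (K := K) inf_le_right
  rw [Subgroup.inf_relIndex_right] at h1
  have h2 : (K.index : ℝ) ≠ 0 := by exact_mod_cast Subgroup.index_ne_zero_of_finite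
  have h3 : ((H ⊓ K).index : ℝ) ≠ 0 := by exact_mod_cast Subgroup.index_ne_zero_of_finite
  have h4 : (H.relIndex K : ℝ) ≠ 0 := by
    intro h
    rw [← h1, Nat.cast_mul, h, zero_mul] at h3
    exact h3 rfl
  rw [← h1, Nat.cast_mul, Real.logb_mul h4 h2]
  ring

/-- A codebook for the mutual information of the quotients by two subgroups. -/
theorem Subgroup.exists_codebook {Γ : Type*} [Group Γ] [Fintype Γ] [DecidableEq Γ]
    (H L : Subgroup Γ) : ∃ (C : Finset Γ) (φ : Γ → Γ), (∀ g, φ g ∈ C) ∧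
      (∀ g, ∃ k ∈ L, (φ g * k)⁻¹ * g ∈ H) ∧
      Real.logb 2 C.card ≤ Real.logb 2 H.index + Real.logb 2 L.index -
        Real.logb 2 (H ⊓ L).index + Real.logb 2 (Real.log H.index + 1) ∧
      ∃ r : ℝ, (∀ c, ((univ.filter fun g => φ g = c).card : ℝ) / Fintype.card Γ ≤ r) ∧
        Real.logb 2 (1 / r) = Real.logb 2 H.index + Real.logb 2 L.index -
          Real.logb 2 (H ⊓ L).index := by
  classical
  -- Since `|L * H| = |H| * [L : H ⊓ L]`, the logarithm of `|Γ| / |P|` is exactly the mutual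
  -- information of the quotients by `H` and `L`.
  set P : Finset Γ := ((L : Set Γ) * (H : Set Γ)).toFinset with hPdef
  have hP1 : (1 : Γ) ∈ P := by
    rw [hPdef, Set.mem_toFinset]
    exact ⟨1, L.one_mem, 1, H.one_mem, one_mul 1⟩
  have hPcard : (P.card : ℝ) = Nat.card H * H.relIndex L := by
    rw [← Nat.cast_mul, ← Subgroup.card_mul_eq_card_mul_relIndex, hPdef,
      Nat.card_eq_card_toFinset]
  have hΓ : (0 : ℝ) < Fintype.card Γ := by exact_mod_cast Fintype.card_pos
  have hP0 : (0 : ℝ) < P.card := by exact_mod_cast Finset.card_pos.mpr ⟨1, hP1⟩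
  have hratio : Real.logb 2 (Fintype.card Γ / P.card) = Real.logb 2 H.index +
      Real.logb 2 L.index - Real.logb 2 (H ⊓ L).index := by
    have h1 := H.card_mul_index
    have h2 : (Nat.card H : ℝ) ≠ 0 := by exact_mod_cast Nat.card_pos.ne'
    have h3 : (H.relIndex L : ℝ) ≠ 0 := by
      intro h
      rw [hPcard, h, mul_zero] at hP0
      exact lt_irrefl _ hP0
    have h4 : (H.index : ℝ) ≠ 0 := by exact_mod_cast Subgroup.index_ne_zero_of_finite
    rw [hPcard, ← Nat.card_eq_fintype_card, ← h1, Nat.cast_mul, mul_div_mul_left _ _ h2,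
      Real.logb_div h4 h3, logb_relIndex]
    ring
  obtain ⟨C, hC, hCcard⟩ := exists_translates_cover P ⟨1, hP1⟩ H (by
    intro g hg h hh
    rw [hPdef, Set.mem_toFinset] at hg ⊢
    obtain ⟨a, ha, b, hb, rfl⟩ := hg
    exact ⟨a, ha, b * h, H.mul_mem hb hh, (mul_assoc _ _ _).symm⟩)
  choose φ hφC hφ using hC
  refine ⟨C, φ, hφC, fun g => ?_, ?_, P.card / Fintype.card Γ, fun c => ?_, ?_⟩
  · have := hφ g
    rw [hPdef, Set.mem_toFinset] at this
    obtain ⟨a, ha, b, hb, hab⟩ := this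
    refine ⟨a, ha, ?_⟩
    have h2 : (φ g * a)⁻¹ * g = a⁻¹ * ((φ g)⁻¹ * g) := by group
    rw [h2, ← hab]
    simpa using hb
  · have hidx : (1 : ℝ) ≤ H.index := by
      exact_mod_cast Nat.one_le_iff_ne_zero.mpr Subgroup.index_ne_zero_of_finite
    have hCpos : (0 : ℝ) < C.card := by exact_mod_cast Finset.card_pos.mpr ⟨_, hφC 1⟩
    have hlog : 0 ≤ Real.log H.index := Real.log_nonneg hidx
    rw [← hratio, ← Real.logb_mul (by positivity) (by positivity)]
    exact Real.logb_le_logb_of_le one_lt_two hCpos hCcard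
  · refine div_le_div_of_nonneg_right ?_ hΓ.le
    norm_cast
    -- The fibre of `φ` over `c` lies in the translate of `P` by `c`.
    refine Finset.card_le_card_of_injOn (fun a => c⁻¹ * a) (fun a ha => ?_) ?_
    · have ha' : φ a = c := by simpa using ha
      rw [← ha']
      exact hφ a
    · intro a _ b _ h
      exact mul_left_cancel h
  · rw [one_div_div, hratio]

/-- The left cosets of the `K i`, with the variable at `z` replaced by `φ`. -/
def updatedCosets {Γ : Type*} [Group Γ] {E : Type*} (K : E → Subgroup Γ) (z : E) (φ : Γ → Γ)
    (i : E) (g : Γ) : Set Γ :=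
  open Classical in if i = z then {φ g} else {x | g⁻¹ * x ∈ K i}

theorem updatedCosets_self {Γ : Type*} [Group Γ] {E : Type*} {K : E → Subgroup Γ} {z : E}
    {φ : Γ → Γ} {a b : Γ} :
    updatedCosets K z φ z a = updatedCosets K z φ z b ↔ φ a = φ b := by
  simp [updatedCosets]

theorem updatedCosets_of_ne {Γ : Type*} [Group Γ] {E : Type*} {K : E → Subgroup Γ} {z i : E}
    {φ : Γ → Γ} (hi : i ≠ z) {a b : Γ} :
    updatedCosets K z φ i a = updatedCosets K z φ i b ↔ a⁻¹ * b ∈ K i := by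
  simp only [updatedCosets, if_neg hi]
  constructor
  · intro h
    have : b ∈ {x | b⁻¹ * x ∈ K i} := by simp
    rw [← h] at this
    exact this
  · intro h
    ext x
    simp only [Set.mem_ofPred_eq]
    constructor
    · intro hx
      have := (K i).mul_mem ((K i).inv_mem h) hx
      simpa [mul_assoc] using this
    · intro hx
      have := (K i).mul_mem h hx
      simpa [mul_assoc] using this

theorem jointKer_updatedCosets {Γ : Type*} [Group Γ] {E : Type*} (K : E → Subgroup Γ) {z : E}
    (φ : Γ → Γ) {A : Set E} (hA : z ∉ A) :
    jointKer (updatedCosets K z φ) A = QuotientGroup.leftRel (⨅ i ∈ A, K i) := by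
  ext a b
  rw [jointKer_iff, QuotientGroup.leftRel_apply]
  simp only [Subgroup.mem_iInf]
  exact forall₂_congr fun i hi => updatedCosets_of_ne (by rintro rfl; exact hA hi)

/-- Each `g` lies in `φ g * κ g * H` with `κ g ∈ L`. The codeword `φ g` and the class of `κ g`
modulo `H ⊓ L` therefore determine the coset of `g`, and this pair takes at most `|C| * [L : H ⊓ L]`
values. -/
theorem setoidEntropy_updatedCosets_insert_le {Γ : Type*} [Group Γ] [Fintype Γ] {E : Type*}
    (K : E → Subgroup Γ) {z : E} {φ : Γ → Γ} {C : Finset Γ} (hφC : ∀ g, φ g ∈ C) {A : Set E}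
    (hA : z ∉ A) (L : Subgroup Γ) (hdec : ∀ g, ∃ k ∈ L, (φ g * k)⁻¹ * g ∈ ⨅ i ∈ A, K i) :
    setoidEntropy (fun _ : Γ => (1 : ℝ) / Fintype.card Γ)
      (jointKer (updatedCosets K z φ) (insert z A)) ≤ Real.logb 2 C.card +
        (Real.logb 2 ((⨅ i ∈ A, K i) ⊓ L).index - Real.logb 2 L.index) := by
  classical
  have hp := uniform_mem_stdSimplex Γ
  have hker := jointKer_updatedCosets K φ hA
  generalize (⨅ i ∈ A, K i) = H at hdec hker ⊢
  choose κ hκL hκ using hdec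
  have := Fintype.ofFinite (L ⧸ H.subgroupOf L)
  have hle : Setoid.ker (fun g => ((⟨φ g, hφC g⟩ : C),
      ((⟨κ g, hκL g⟩ : L) : L ⧸ H.subgroupOf L))) ≤
        jointKer (updatedCosets K z φ) (insert z A) := by
    intro a b hab
    rw [Setoid.ker_def, Prod.mk.injEq, Subtype.mk.injEq, QuotientGroup.eq,
      Subgroup.mem_subgroupOf] at hab
    obtain ⟨h1, h2⟩ := hab
    have h3 : jointKer (updatedCosets K z φ) A a b := by
      rw [hker, QuotientGroup.leftRel_apply]
      have h4 := H.mul_mem (H.mul_mem (H.inv_mem (hκ a)) h2) (hκ b)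
      rw [h1] at h4
      simpa [mul_assoc] using h4
    rw [jointKer_iff] at h3 ⊢
    rintro i (rfl | hi)
    · exact updatedCosets_self.mpr h1
    · exact h3 i hi
  refine (setoidEntropy_anti hp.1 hle).trans ((setoidEntropy_ker_le hp _).trans ?_)
  have hCpos : (C.card : ℝ) ≠ 0 := by exact_mod_cast (Finset.card_pos.mpr ⟨_, hφC 1⟩).ne'
  have hrel : (H.relIndex L : ℝ) ≠ 0 := by
    exact_mod_cast (Subgroup.index_ne_zero_of_finite (H := H.subgroupOf L))
  rw [Fintype.card_prod, Fintype.card_coe, ← Nat.card_eq_fintype_card (α := L ⧸ _),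
    ← Subgroup.index_eq_card, ← Subgroup.relIndex, Nat.cast_mul, Real.logb_mul hCpos hrel,
    logb_relIndex]

/-- An approximate form of the Ahlswede–Körner lemma for families of subgroups: the variable `z`
is replaced by a variable which carries the mutual information of `W` and `Y`. -/
theorem exists_entropic_commonInformation {Γ : Type} [Group Γ] [Finite Γ] {E : Type*}
    (K : E → Subgroup Γ) (z : E) (W Y : Set E) (hz : z ∉ W) :
    ∃ h : Set E → ℝ, IsEntropic h ∧ (∀ A, z ∉ A → h A = subgroupRank K A) ∧
      (∀ A ⊆ W, h (insert z A) ≤ subgroupRank K (A ∪ Y) + subgroupRank K W -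
        subgroupRank K (W ∪ Y) +
          Real.logb 2 (Real.log 2 * subgroupRank K W + 1)) ∧
      subgroupRank K W + subgroupRank K Y - subgroupRank K (W ∪ Y) ≤ h {z} := by
  classical
  have := Fintype.ofFinite Γ
  have hunion : ∀ S T, subgroupRank K (S ∪ T) =
      Real.logb 2 ((⨅ i ∈ S, K i) ⊓ (⨅ i ∈ T, K i)).index := fun S T => by
    rw [subgroupRank, _root_.iInf_union]
  have hlogW : Real.log 2 * subgroupRank K W = Real.log (⨅ i ∈ W, K i).index := by
    rw [subgroupRank, Real.logb, mul_div_cancel₀ _ (Real.log_pos one_lt_two).ne']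
  obtain ⟨C, φ, hφC, hdec, hC, r, hr, hr'⟩ :=
    Subgroup.exists_codebook (⨅ i ∈ W, K i) (⨅ i ∈ Y, K i)
  have hp := uniform_mem_stdSimplex Γ
  rw [← hlogW] at hC
  refine ⟨_, isEntropic_iff.mpr ⟨Γ, inferInstance, _, hp, fun _ => Set Γ, updatedCosets K z φ,
    fun T => rfl⟩, fun A hA => ?_, fun A hA => ?_, ?_⟩
  · rw [jointKer_updatedCosets K φ hA, setoidEntropy_uniform_leftRel, subgroupRank]
  · refine (setoidEntropy_updatedCosets_insert_le K hφC (fun h => hz (hA h))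
      (⨅ i ∈ Y, K i) fun g => ?_).trans ?_
    · obtain ⟨k, hk, hg⟩ := hdec g
      -- Decoding modulo the subgroup of `W` also decodes modulo the larger subgroup of any `A ⊆ W`.
      exact ⟨k, hk, (biInf_mono hA : ⨅ i ∈ W, K i ≤ ⨅ i ∈ A, K i) hg⟩
    · have hW : subgroupRank K W = Real.logb 2 (⨅ i ∈ W, K i).index := rfl
      rw [hunion, hunion]
      linarith
  · rw [hunion, subgroupRank, subgroupRank, ← hr']
    refine le_setoidEntropy hp _ fun g => le_trans (le_of_eq ?_) (hr (φ g))
    unfold classMass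
    rw [Finset.sum_const, nsmul_eq_mul, mul_one_div]
    congr 3
    ext a
    simp only [mem_filter, mem_univ, true_and, jointKer_iff, Set.mem_singleton_iff, forall_eq,
      updatedCosets_self]

end

noncomputable section

open Finset Filter Topology

/-! ## The Ahlswede–Körner lemma for limits of entropic functions -/

/-- A pointwise limit of entropic functions. -/
def IsEntropicLimit {E : Type*} (f : Set E → ℝ) : Prop :=
  ∃ g : ℕ → Set E → ℝ, (∀ n, IsEntropic (g n)) ∧
    ∀ T : Set E, Tendsto (fun n => g n T) atTop (𝓝 (f T))

section Limits

variable {E : Type*} {f : Set E → ℝ}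

theorem IsEntropicLimit.isPolymatroid (hf : IsEntropicLimit f) : IsPolymatroid f := by
  obtain ⟨g, hg, hlim⟩ := hf
  refine ⟨?_, fun A B hAB => ?_, fun A B => ?_⟩
  · refine tendsto_nhds_unique (hlim ∅) ?_
    simp only [(hg _).isPolymatroid.map_empty]
    exact tendsto_const_nhds
  · exact le_of_tendsto_of_tendsto' (hlim A) (hlim B) fun n => (hg n).isPolymatroid.mono hAB
  · exact le_of_tendsto_of_tendsto' ((hlim _).add (hlim _)) ((hlim A).add (hlim B))
      fun n => (hg n).isPolymatroid.submodular A B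

theorem IsEntropicLimit.preimage {E' : Type*} (hf : IsEntropicLimit f) (ι : E → E') :
    IsEntropicLimit fun T : Set E' => f (ι ⁻¹' T) := by
  obtain ⟨g, hg, hlim⟩ := hf
  exact ⟨fun n T => g n (ι ⁻¹' T), fun n => (hg n).preimage ι, fun T => hlim _⟩

/-- Simultaneous approximation of the values at the subsets of a finite set. -/
theorem eventually_forall_subset_abs_sub_lt {g : ℕ → Set E → ℝ}
    (hlim : ∀ T : Set E, Tendsto (fun n => g n T) atTop (𝓝 (f T))) {G : Set E} (hG : G.Finite)
    {ε : ℝ} (hε : 0 < ε) : ∀ᶠ n in atTop, ∀ A ⊆ G, |g n A - f A| < ε := by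
  have := (Filter.eventually_all_finite hG.finite_subsets (l := atTop)
    (p := fun A n => |g n A - f A| < ε)).mpr fun A _ => ?_
  · exact this
  · have := Metric.tendsto_nhds.mp (hlim A) ε hε
    simpa [Real.dist_eq] using this

theorem IsEntropicLimit.exists_approx (hf : IsEntropicLimit f) {G : Set E} (hG : G.Finite)
    {ε : ℝ} (hε : 0 < ε) : ∃ g : Set E → ℝ, IsEntropic g ∧ ∀ A ⊆ G, |g A - f A| < ε := by
  obtain ⟨g, hg, hlim⟩ := hf
  obtain ⟨n, hn⟩ := (eventually_forall_subset_abs_sub_lt hlim hG hε).exists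
  exact ⟨g n, hg n, hn⟩

/-- The codebook overhead is logarithmic in a quantity of order `n`, so it vanishes after division
by `n`. -/
theorem tendsto_logb_add_one_div {x : ℕ → ℝ} (hx : ∀ n, 0 ≤ x n) {c w : ℝ} (hc : 0 ≤ c)
    (hlim : Tendsto (fun n : ℕ => x n / n) atTop (𝓝 w)) :
    Tendsto (fun n : ℕ => Real.logb 2 (c * x n + 1) / n) atTop (𝓝 0) := by
  have hl2 : 0 < Real.log 2 := Real.log_pos one_lt_two
  have h1 : Tendsto (fun N : ℕ => (√(N : ℝ))⁻¹) atTop (𝓝 0) :=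
    (Real.tendsto_sqrt_atTop.comp tendsto_natCast_atTop_atTop).inv_tendsto_atTop
  have h2 : Tendsto (fun N : ℕ => c * (x N / N) + 1 / N) atTop (𝓝 (c * w + 0)) :=
    (hlim.const_mul c).add tendsto_one_div_atTop_nhds_zero_nat
  have hup : Tendsto (fun N : ℕ => 2 * √(c * (x N / N) + 1 / N) * (√(N : ℝ))⁻¹ / Real.log 2)
      atTop (𝓝 0) := by
    simpa using ((((h2.sqrt).const_mul 2).mul h1).div_const (Real.log 2))
  refine tendsto_of_tendsto_of_tendsto_of_le_of_le tendsto_const_nhds hup (fun n => ?_)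
    (fun n => ?_)
  · exact div_nonneg (Real.logb_nonneg one_lt_two (by nlinarith [mul_nonneg hc (hx n)]))
      (by positivity)
  · have hpos : 0 < c * x n + 1 := by nlinarith [mul_nonneg hc (hx n)]
    have h3 := Real.log_le_sub_one_of_pos (Real.sqrt_pos.mpr hpos)
    rw [Real.log_sqrt hpos.le] at h3
    have h4 : c * (x n / n) + 1 / n = (c * x n + 1) / n := by ring
    have h5 : 2 * √(c * (x n / n) + 1 / n) * (√(n : ℝ))⁻¹ / Real.log 2 =
        2 * √(c * x n + 1) / Real.log 2 / n := by
      rw [h4, Real.sqrt_div hpos.le, div_eq_mul_inv √_, mul_assoc, mul_assoc, ← mul_inv,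
        Real.mul_self_sqrt (by positivity)]
      ring
    rw [h5, Real.logb]
    refine div_le_div_of_nonneg_right (div_le_div_of_nonneg_right ?_ hl2.le) (by positivity)
    linarith

theorem subgroupRank_nonneg {Γ : Type*} [Group Γ] [Finite Γ] (K : E → Subgroup Γ) (T : Set E) :
    0 ≤ subgroupRank K T := by
  refine Real.logb_nonneg one_lt_two ?_
  exact_mod_cast Nat.one_le_iff_ne_zero.mpr Subgroup.index_ne_zero_of_finite

theorem IsEntropicLimit.exists_approx_commonInformation (hf : IsEntropicLimit f) {G : Set E}
    (hG : G.Finite) {z : E} (hz : z ∉ G) {W Y : Set E} (hW : W ⊆ G) (hY : Y ⊆ G) {ε : ℝ}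
    (hε : 0 < ε) :
    ∃ q : Set E → ℝ, IsEntropic q ∧ (∀ A, q A = q (A ∩ insert z G)) ∧
      (∀ A ⊆ G, |q A - f A| < ε) ∧
      (∀ A ⊆ W, q (insert z A) ≤ f (A ∪ Y) + f W - f (W ∪ Y) + ε) ∧
      f W + f Y - f (W ∪ Y) - ε ≤ q {z} := by
  -- The upper bound spends eight errors of size `ε / 8`: two for each of the three ranks on the
  -- right, one for the codebook overhead and one for scaling by `1 / N`.
  obtain ⟨g, hg, hgf⟩ := hf.exists_approx hG (ε := ε / 8) (by positivity)
  obtain ⟨Γ, _, _, K, hK⟩ := hg.exists_subgroups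
  have hover := tendsto_logb_add_one_div (x := fun N => subgroupRank (K N) W)
    (fun N => subgroupRank_nonneg _ _) (Real.log_pos one_lt_two).le (hK W)
  obtain ⟨N, hN1, hN2, hN0⟩ := ((eventually_forall_subset_abs_sub_lt
    (g := fun N T => subgroupRank (K N) T / N) hK hG (ε := ε / 8) (by positivity)).and
    ((hover.eventually_lt_const (by positivity : 0 < ε / 8)).and (eventually_gt_atTop 0))).exists
  obtain ⟨h, hh, hh1, hh2, hh3⟩ :=
    exists_entropic_commonInformation (K N) z W Y (fun h => hz (hW h))
  obtain ⟨q, hq, hqlim⟩ := hh.exists_tendsto_div hN0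
  obtain ⟨k, hk⟩ := (eventually_forall_subset_abs_sub_lt hqlim (hG.insert z) (ε := ε / 8)
    (by positivity)).exists
  have hN0' : (0 : ℝ) < N := by exact_mod_cast hN0
  have hWY : W ∪ Y ⊆ G := Set.union_subset hW hY
  refine ⟨fun A => q k (A ∩ insert z G), (hq k).inter _, fun A => ?_, fun A hA => ?_,
    fun A hA => ?_, ?_⟩
  · simp only [Set.inter_assoc, Set.inter_self]
  · have hA' : A ⊆ insert z G := hA.trans (Set.subset_insert _ _)
    simp only [Set.inter_eq_left.mpr hA']
    have h1 := abs_lt.mp (hk A hA')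
    have h2 := abs_lt.mp (hN1 A hA)
    have h3 := abs_lt.mp (hgf A hA)
    rw [hh1 A fun hzA => hz (hA hzA)] at h1
    rw [abs_lt]
    constructor <;> linarith
  · have hA' : insert z A ⊆ insert z G := Set.insert_subset_insert (hA.trans hW)
    simp only [Set.inter_eq_left.mpr hA']
    have hAY : A ∪ Y ⊆ G := Set.union_subset (hA.trans hW) hY
    have h0 := abs_lt.mp (hk _ hA')
    have h1 := div_le_div_of_nonneg_right (hh2 A hA) hN0'.le
    rw [add_div, sub_div, add_div] at h1
    have a1 := abs_lt.mp (hN1 _ hAY)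
    have a2 := abs_lt.mp (hN1 _ hW)
    have a3 := abs_lt.mp (hN1 _ hWY)
    have b1 := abs_lt.mp (hgf _ hAY)
    have b2 := abs_lt.mp (hgf _ hW)
    have b3 := abs_lt.mp (hgf _ hWY)
    linarith
  · have hA' : {z} ⊆ insert z G := by simp
    simp only [Set.inter_eq_left.mpr hA']
    have h0 := abs_lt.mp (hk _ hA')
    have h1 := div_le_div_of_nonneg_right hh3 hN0'.le
    rw [sub_div, add_div] at h1
    have a1 := abs_lt.mp (hN1 _ hY)
    have a2 := abs_lt.mp (hN1 _ hW)
    have a3 := abs_lt.mp (hN1 _ hWY)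
    have b1 := abs_lt.mp (hgf _ hY)
    have b2 := abs_lt.mp (hgf _ hW)
    have b3 := abs_lt.mp (hgf _ hWY)
    linarith

/-- The Ahlswede–Körner lemma: the element `z`, outside the finite set `G`, can be
chosen as a carrier of the mutual information of `W` and `Y` which is a function of `W`. -/
theorem IsEntropicLimit.exists_commonInformation (hf : IsEntropicLimit f) {G : Set E}
    (hG : G.Finite) {z : E} (hz : z ∉ G) {W Y : Set E} (hW : W ⊆ G)
    (hY : Y ⊆ G) :
    ∃ f' : Set E → ℝ, IsEntropicLimit f' ∧ (∀ A ⊆ G, f' A = f A) ∧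
      (∀ A ⊆ W, f' (insert z A) ≤ f (A ∪ Y) + f W - f (W ∪ Y)) ∧
      f W + f Y - f (W ∪ Y) ≤ f' {z} := by
  have hε : ∀ n : ℕ, (0 : ℝ) < 1 / ((n : ℝ) + 1) := fun n => by positivity
  have hε1 : ∀ n : ℕ, 1 / ((n : ℝ) + 1) ≤ 1 := fun n => by
    rw [div_le_one (by positivity)]
    linarith [(Nat.cast_nonneg n : (0 : ℝ) ≤ n)]
  choose q hq hqG hqf hq1 hq2 using fun n : ℕ =>
    hf.exists_approx_commonInformation hG hz hW hY (hε n)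
  set G' := insert z G with hG'
  have : Finite {A : Set E // A ⊆ G'} := (hG.insert z).finite_subsets
  -- Submodularity bounds every value of `q n` by the sum of its values at `G` and at `z`, each
  -- within 1 of its target bound. As `q n` is determined by its values on the subsets of a finite
  -- set, a subsequence converges.
  set M : ℝ := f G + 1 + (f (∅ ∪ Y) + f W - f (W ∪ Y) + 1) with hM
  have hbound : ∀ n (A : Set E), q n A ∈ Set.Icc 0 M := by
    intro n A
    have hp := (hq n).isPolymatroid
    refine ⟨by rw [← hp.map_empty]; exact hp.mono (Set.empty_subset _), ?_⟩
    have h1 : q n A ≤ q n G' := by rw [hqG]; exact hp.mono Set.inter_subset_right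
    have h2 := hp.submodular G {z}
    have h3 : q n (G ∩ {z}) = 0 := by
      rw [Set.inter_singleton_eq_empty.mpr hz, hp.map_empty]
    have h4 := (abs_lt.mp (hqf n G subset_rfl)).2
    have h5 := hq1 n ∅ (Set.empty_subset _)
    rw [Set.union_singleton, ← hG', h3] at h2
    rw [insert_empty_eq] at h5
    have := hε1 n
    linarith
  obtain ⟨a, -, φ, hφ, ha⟩ := (isCompact_univ_pi fun _ : {A : Set E // A ⊆ G'} =>
    isCompact_Icc (a := (0 : ℝ)) (b := M)).tendsto_subseq
      (x := fun n A => q n A.1) (fun n A _ => hbound n A.1)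
  rw [tendsto_pi_nhds] at ha
  have hlim : ∀ A, Tendsto (fun n => q (φ n) A) atTop
      (𝓝 (a ⟨A ∩ G', Set.inter_subset_right⟩)) := by
    intro A
    simp_rw [hqG _ A]
    exact ha ⟨A ∩ G', Set.inter_subset_right⟩
  have hε0 : Tendsto (fun n => 1 / ((φ n : ℝ) + 1)) atTop (𝓝 0) :=
    tendsto_one_div_add_atTop_nhds_zero_nat.comp hφ.tendsto_atTop
  refine ⟨fun A => a ⟨A ∩ G', Set.inter_subset_right⟩, ⟨fun n => q (φ n), fun n => hq _, hlim⟩,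
    fun A hA => ?_, fun A hA => ?_, ?_⟩
  · refine tendsto_nhds_unique (hlim A) ?_
    rw [tendsto_iff_dist_tendsto_zero]
    refine squeeze_zero (fun _ => dist_nonneg) (fun n => ?_) hε0
    rw [Real.dist_eq]
    exact (hqf _ A hA).le
  · refine le_of_tendsto_of_tendsto' (hlim _) ?_ fun n => hq1 (φ n) A hA
    simpa using (tendsto_const_nhds (x := f (A ∪ Y) + f W - f (W ∪ Y))).add hε0
  · refine le_of_tendsto_of_tendsto' ?_ (hlim _) fun n => hq2 (φ n)
    simpa using (tendsto_const_nhds (x := f W + f Y - f (W ∪ Y))).sub hε0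

end Limits

end

noncomputable section

open Finset Filter Topology

/-! ## Closure in polymatroids -/

section Closure

variable {E : Type*} {f : Set E → ℝ}

theorem IsPolymatroid.mem_closure_iff (hf : IsPolymatroid f) {A : Set E} {x : E} :
    x ∈ polyClosure f A ↔ f (insert x A) ≤ f A := by
  rw [polyClosure, Set.mem_ofPred_eq, Set.union_singleton]
  exact ⟨fun h => h.ge, fun h => le_antisymm (hf.mono (Set.subset_insert _ _)) h⟩

theorem IsPolymatroid.subset_closure (hf : IsPolymatroid f) (A : Set E) :
    A ⊆ polyClosure f A := fun x hx => by
  rw [hf.mem_closure_iff, Set.insert_eq_of_mem hx]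

theorem IsPolymatroid.closure_mono (hf : IsPolymatroid f) {A B : Set E} (h : A ⊆ B) :
    polyClosure f A ⊆ polyClosure f B := by
  intro x hx
  rw [hf.mem_closure_iff] at hx ⊢
  have h1 := hf.submodular (insert x A) B
  have h2 : f A ≤ f (insert x A ∩ B) := hf.mono (Set.subset_inter (Set.subset_insert _ _) h)
  rw [Set.insert_union, Set.union_eq_self_of_subset_left h] at h1
  linarith

theorem IsPolymatroid.rank_union_of_subset_closure (hf : IsPolymatroid f) {A B : Set E}
    (hB : B.Finite) (h : B ⊆ polyClosure f A) : f (A ∪ B) = f A := by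
  induction B, hB using Set.Finite.induction_on with
  | empty => simp
  | @insert x B hx hB ih =>
    rw [Set.insert_subset_iff] at h
    rw [← ih h.2, Set.union_insert]
    refine le_antisymm ?_ (hf.mono (Set.subset_insert _ _))
    exact hf.mem_closure_iff.mp (hf.closure_mono Set.subset_union_left h.1)

theorem IsPolymatroid.rank_le_of_subset_closure (hf : IsPolymatroid f) {A B : Set E}
    (hB : B.Finite) (h : B ⊆ polyClosure f A) : f B ≤ f A :=
  (hf.mono Set.subset_union_right).trans (hf.rank_union_of_subset_closure hB h).le

theorem IsPolymatroid.mem_closure_trans (hf : IsPolymatroid f) {A B : Set E} (hB : B.Finite)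
    (h : B ⊆ polyClosure f A) {x : E} (hx : x ∈ polyClosure f B) : x ∈ polyClosure f A := by
  have h1 := hf.mem_closure_iff.mp (hf.closure_mono (Set.subset_union_right (s := A)) hx)
  rw [hf.rank_union_of_subset_closure hB h] at h1
  exact hf.mem_closure_iff.mpr
    ((hf.mono (Set.insert_subset_insert Set.subset_union_left)).trans h1)

theorem IsPolymatroid.rank_insert_le (hf : IsPolymatroid f) (x : E) (A : Set E) :
    f (insert x A) ≤ f {x} + f A := by
  have h1 := hf.submodular {x} A
  have h2 := hf.mono (Set.empty_subset ({x} ∩ A))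
  rw [hf.map_empty] at h2
  rw [Set.singleton_union] at h1
  linarith

/-- The intersection of two distinct planes of a space of rank `4` has rank at most `2`. -/
theorem IsPolymatroid.rank_le_two_of_subset_closure (hf : IsPolymatroid f) {S A B : Set E}
    (hS : S.Finite) (hA : S ⊆ polyClosure f A) (hB : S ⊆ polyClosure f B) (hA3 : f A ≤ 3)
    (hB3 : f B ≤ 3) (hAB : 4 ≤ f (A ∪ B)) : f S ≤ 2 := by
  have h1 := hf.submodular (A ∪ S) (B ∪ S)
  have h2 : f (A ∪ B) ≤ f (A ∪ S ∪ (B ∪ S)) :=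
    hf.mono (Set.union_subset_union Set.subset_union_left Set.subset_union_left)
  have h3 : f S ≤ f ((A ∪ S) ∩ (B ∪ S)) :=
    hf.mono (Set.subset_inter Set.subset_union_right Set.subset_union_right)
  rw [hf.rank_union_of_subset_closure hS hA, hf.rank_union_of_subset_closure hS hB] at h1
  linarith

end Closure

/-! ## Joints of a basis -/

section Joints

variable {E : Type*} {f : Set E → ℝ} {b : Fin 4 → E}

/-- The `b i` are a basis of the polymatroid `f`. -/
structure IsFrame (f : Set E → ℝ) (b : Fin 4 → E) : Prop where
  isPolymatroid : IsPolymatroid f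
  injective : Function.Injective b
  rank_basis : ∀ A : Set E, A ⊆ Set.range b → f A = (A.ncard : ℝ)

/-- `x` is a point of the line through `b i` and `b j`, in general position. -/
structure IsJoint (f : Set E → ℝ) (b : Fin 4 → E) (i j : Fin 4) (x : E) : Prop where
  rank_le : f {x} ≤ 1
  mem : x ∈ polyClosure f {b i, b j}
  left : b i ∈ polyClosure f {b j, x}
  right : b j ∈ polyClosure f {b i, x}

theorem IsJoint.mem_of (hp : IsPolymatroid f) {i j : Fin 4} {x : E} (h : IsJoint f b i j x)
    {A : Set E} (hi : b i ∈ polyClosure f A) (hj : b j ∈ polyClosure f A) :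
    x ∈ polyClosure f A :=
  hp.mem_closure_trans (Set.toFinite _) (by simp [Set.insert_subset_iff, hi, hj]) h.mem

theorem IsJoint.left_of (hp : IsPolymatroid f) {i j : Fin 4} {x : E} (h : IsJoint f b i j x)
    {A : Set E} (hj : b j ∈ polyClosure f A) (hx : x ∈ polyClosure f A) :
    b i ∈ polyClosure f A :=
  hp.mem_closure_trans (Set.toFinite _) (by simp [Set.insert_subset_iff, hj, hx]) h.left

theorem IsJoint.right_of (hp : IsPolymatroid f) {i j : Fin 4} {x : E} (h : IsJoint f b i j x)
    {A : Set E} (hi : b i ∈ polyClosure f A) (hx : x ∈ polyClosure f A) :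
    b j ∈ polyClosure f A :=
  hp.mem_closure_trans (Set.toFinite _) (by simp [Set.insert_subset_iff, hi, hx]) h.right

theorem IsJoint.symm {i j : Fin 4} {x : E} (h : IsJoint f b i j x) : IsJoint f b j i x :=
  ⟨h.rank_le, by rw [Set.pair_comm]; exact h.mem, h.right, h.left⟩

/-- Collinearity in the form used for chasing spans: a set spanning `x` and `y` also spans `z`. -/
theorem IsPolymatroid.mem_closure_of_rank_le (hp : IsPolymatroid f) {x y z : E}
    (h : f {x, y, z} ≤ f {x, y}) {A : Set E} (hx : x ∈ polyClosure f A)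
    (hy : y ∈ polyClosure f A) : z ∈ polyClosure f A := by
  refine hp.mem_closure_trans (B := {x, y}) (Set.toFinite _)
    (by simp [Set.insert_subset_iff, hx, hy]) (hp.mem_closure_iff.mpr ?_)
  rwa [Set.insert_comm, Set.pair_comm z y]

namespace IsFrame

theorem rank_image (hf : IsFrame f b) (s : Finset (Fin 4)) : f (b '' s) = s.card := by
  rw [hf.rank_basis _ (Set.image_subset_range _ _), Set.ncard_image_of_injective _ hf.injective,
    Set.ncard_coe_finset]

theorem rank_singleton (hf : IsFrame f b) (i : Fin 4) : f {b i} = 1 := by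
  simpa using hf.rank_image {i}

theorem rank_pair (hf : IsFrame f b) {i j : Fin 4} (hij : i ≠ j) : f {b i, b j} = 2 := by
  have := hf.rank_image {i, j}
  rw [Finset.card_pair hij] at this
  simpa [Set.image_insert_eq] using this

theorem rank_triple (hf : IsFrame f b) {i j k : Fin 4} (hij : i ≠ j) (hik : i ≠ k)
    (hjk : j ≠ k) : f {b i, b j, b k} = 3 := by
  have := hf.rank_image {i, j, k}
  rw [Finset.card_eq_three.mpr ⟨i, j, k, hij, hik, hjk, rfl⟩] at this
  simpa [Set.image_insert_eq] using this

theorem rank_quadruple (hf : IsFrame f b) {i j k l : Fin 4} (hij : i ≠ j) (hik : i ≠ k)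
    (hil : i ≠ l) (hjk : j ≠ k) (hjl : j ≠ l) (hkl : k ≠ l) : f {b i, b j, b k, b l} = 4 := by
  have := hf.rank_image {i, j, k, l}
  rw [Finset.card_insert_of_notMem (by simp [hij, hik, hil]),
    Finset.card_eq_three.mpr ⟨j, k, l, hjk, hjl, hkl, rfl⟩] at this
  norm_num [Set.image_insert_eq] at this
  exact this

theorem rank_joint (hf : IsFrame f b) {i j : Fin 4} (hij : i ≠ j) {x : E}
    (hx : IsJoint f b i j x) : f {x} = 1 := by
  have hp := hf.isPolymatroid
  refine le_antisymm hx.rank_le ?_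
  have h1 := hp.rank_le_of_subset_closure (A := {b i, x}) (B := {b i, b j}) (Set.toFinite _)
    (by simp [Set.insert_subset_iff, hx.right, hp.subset_closure {b i, x} (Set.mem_insert _ _)])
  have h2 := hp.rank_insert_le (b i) {x}
  rw [hf.rank_pair hij] at h1
  rw [hf.rank_singleton] at h2
  linarith

theorem rank_left_joint (hf : IsFrame f b) {i j : Fin 4} (hij : i ≠ j) {x : E}
    (hx : IsJoint f b i j x) : f {b i, x} = 2 := by
  have hp := hf.isPolymatroid
  have h1 := hp.rank_le_of_subset_closure (A := {b i, x}) (B := {b i, b j}) (Set.toFinite _)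
    (by simp [Set.insert_subset_iff, hx.right, hp.subset_closure {b i, x} (Set.mem_insert _ _)])
  have h2 := hp.rank_insert_le (b i) {x}
  rw [hf.rank_pair hij] at h1
  rw [hf.rank_singleton, hf.rank_joint hij hx] at h2
  linarith

/-- Together with `b j` the two points span `b i, b j, b k`, which has rank 3. -/
theorem rank_joint_pair (hf : IsFrame f b) {i j k : Fin 4} (hij : i ≠ j) (hik : i ≠ k)
    (hjk : j ≠ k) {x y : E} (hx : IsJoint f b i j x) (hy : IsJoint f b j k y) :
    f {x, y} = 2 := by
  have hp := hf.isPolymatroid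
  have hs := hp.subset_closure {b j, x, y}
  simp only [Set.insert_subset_iff, Set.singleton_subset_iff] at hs
  obtain ⟨hsj, hsx, hsy⟩ := hs
  have h1 := hp.rank_le_of_subset_closure (A := {b j, x, y}) (B := {b i, b j, b k})
    (Set.toFinite _) (by simp [Set.insert_subset_iff, hsj, hx.left_of hp hsj hsx,
      hy.right_of hp hsj hsy])
  have h2 := hp.rank_insert_le (b j) {x, y}
  have h3 := hp.rank_insert_le x {y}
  rw [hf.rank_triple hij hik hjk] at h1
  rw [hf.rank_singleton] at h2
  rw [hf.rank_joint hij hx, hf.rank_joint hjk hy] at h3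
  linarith

end IsFrame

/-- Adding the intersection point of the lines through `b i`, `b j` and through `x`, `y`. -/
theorem IsEntropicLimit.exists_joint (hlim : IsEntropicLimit f) (hf : IsFrame f b)
    {i j k l : Fin 4} (hij : i ≠ j) (hik : i ≠ k) (hil : i ≠ l) (hjk : j ≠ k) (hjl : j ≠ l)
    (hkl : k ≠ l) {x y x' y' w : E} (hx : IsJoint f b i k x) (hy : IsJoint f b k j y)
    (hx' : IsJoint f b i l x') (hy' : IsJoint f b l j y') (hw : IsJoint f b k l w)
    (hxw : f {x', w, x} ≤ 2) (hyw : f {y', w, y} ≤ 2) {G : Set E} (hG : G.Finite)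
    (hbG : Set.range b ⊆ G) (hxG : x ∈ G) (hyG : y ∈ G) (hxG' : x' ∈ G) (hyG' : y' ∈ G)
    {z : E} (hz : z ∉ G) :
    ∃ f' : Set E → ℝ, IsEntropicLimit f' ∧ (∀ A ⊆ G, f' A = f A) ∧ IsJoint f' b i j z ∧
      f' {x, y, z} ≤ 2 := by
  have hp := hf.isPolymatroid
  have hbG' : ∀ i, b i ∈ G := fun i => hbG ⟨i, rfl⟩
  -- ranks of the sets spanned by the given points
  have rW : f {b i, b j, x, y} ≤ 3 := by
    rw [← hf.rank_triple hij hik hjk]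
    have hs := hp.subset_closure {b i, b j, b k}
    simp only [Set.insert_subset_iff, Set.singleton_subset_iff] at hs
    obtain ⟨si, sj, sk⟩ := hs
    exact hp.rank_le_of_subset_closure (Set.toFinite _)
      (by simp [Set.insert_subset_iff, si, sj, hx.mem_of hp si sk, hy.mem_of hp sk sj])
  have riV : 3 ≤ f {b i, x, y} := by
    rw [← hf.rank_triple hij hik hjk]
    have hs := hp.subset_closure {b i, x, y}
    simp only [Set.insert_subset_iff, Set.singleton_subset_iff] at hs
    obtain ⟨si, sx, sy⟩ := hs
    have sk := hx.right_of hp si sx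
    exact hp.rank_le_of_subset_closure (Set.toFinite _)
      (by simp [Set.insert_subset_iff, si, sk, hy.right_of hp sk sy])
  have rjV : 3 ≤ f {b j, x, y} := by
    rw [← hf.rank_triple hij hik hjk]
    have hs := hp.subset_closure {b j, x, y}
    simp only [Set.insert_subset_iff, Set.singleton_subset_iff] at hs
    obtain ⟨sj, sx, sy⟩ := hs
    have sk := hy.left_of hp sj sy
    exact hp.rank_le_of_subset_closure (Set.toFinite _)
      (by simp [Set.insert_subset_iff, sj, sk, hx.left_of hp sk sx])
  have rW' : 3 ≤ f {b i, b j, x, y} := riV.trans (hp.mono (by simp [Set.insert_subset_iff]))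
  have rY : f {x', y'} = 2 := hf.rank_joint_pair hil hij hjl.symm hx' hy'
  have rV : f {x, y} = 2 := hf.rank_joint_pair hik hij hjk.symm hx hy
  have rUY : f {b i, b j, x', y'} ≤ 3 := by
    rw [← hf.rank_triple hij hil hjl]
    have hs := hp.subset_closure {b i, b j, b l}
    simp only [Set.insert_subset_iff, Set.singleton_subset_iff] at hs
    obtain ⟨si, sj, sl⟩ := hs
    exact hp.rank_le_of_subset_closure (Set.toFinite _)
      (by simp [Set.insert_subset_iff, si, sj, hx'.mem_of hp si sl, hy'.mem_of hp sl sj])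
  -- The two lines are coplanar: `x` lies on the line `x' w` and `y` on the line `y' w`, so both lie
  -- in the plane of `x', y', w`.
  have rVY : f {x, y, x', y'} ≤ 3 := by
    have h1 : f {x', y', w} ≤ 3 := by
      have h2 := hp.rank_insert_le x' {y', w}
      have h3 := hp.rank_insert_le y' {w}
      have := hx'.rank_le
      have := hy'.rank_le
      have := hw.rank_le
      linarith
    refine le_trans ?_ h1
    have hs := hp.subset_closure {x', y', w}
    simp only [Set.insert_subset_iff, Set.singleton_subset_iff] at hs
    obtain ⟨sx, sy, sw⟩ := hs
    have h2 : f {x', w} = 2 := hf.rank_joint_pair hil hik hkl.symm hx' hw.symm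
    have h3 : f {y', w} = 2 := hf.rank_joint_pair hjl hjk hkl.symm hy'.symm hw.symm
    exact hp.rank_le_of_subset_closure (Set.toFinite _)
      (by simp [Set.insert_subset_iff, sx, sy,
        hp.mem_closure_of_rank_le (hxw.trans h2.ge) sx sw,
        hp.mem_closure_of_rank_le (hyw.trans h3.ge) sy sw])
  have rWY : f {b i, b j, x, y, x', y'} = 4 := by
    rw [← hf.rank_quadruple hij hik hil hjk hjl hkl]
    refine le_antisymm ?_ ?_
    · have hs := hp.subset_closure {b i, b j, b k, b l}
      simp only [Set.insert_subset_iff, Set.singleton_subset_iff] at hs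
      obtain ⟨si, sj, sk, sl⟩ := hs
      exact hp.rank_le_of_subset_closure (Set.toFinite _)
        (by simp [Set.insert_subset_iff, si, sj, hx.mem_of hp si sk, hy.mem_of hp sk sj,
          hx'.mem_of hp si sl, hy'.mem_of hp sl sj])
    · have hs := hp.subset_closure {b i, b j, x, y, x', y'}
      simp only [Set.insert_subset_iff, Set.singleton_subset_iff] at hs
      obtain ⟨si, sj, sx, sy, sx', sy'⟩ := hs
      exact hp.rank_le_of_subset_closure (Set.toFinite _)
        (by simp [Set.insert_subset_iff, si, sj, hx.right_of hp si sx, hx'.right_of hp si sx'])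
  -- `W` lists the generators of both lines, rather than a basis of their plane, because the bounds
  -- on `z` are available only for subsets of `W`. The mutual information of `W` and `Y` is 3 + 2 -
  -- 4 = 1.
  obtain ⟨f', hf', hff', hle, hge⟩ := hlim.exists_commonInformation hG hz
    (W := {b i, b j, x, y}) (Y := {x', y'})
    (by simp [Set.insert_subset_iff, hbG', hxG, hyG])
    (by simp [Set.insert_subset_iff, hxG', hyG'])
  have hp' := hf'.isPolymatroid
  have hWY : ({b i, b j, x, y} ∪ {x', y'} : Set E) = {b i, b j, x, y, x', y'} := by
    simp only [Set.insert_union, Set.singleton_union]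
  have hUY : ({b i, b j} ∪ {x', y'} : Set E) = {b i, b j, x', y'} := by
    simp only [Set.insert_union, Set.singleton_union]
  have hVY : ({x, y} ∪ {x', y'} : Set E) = {x, y, x', y'} := by
    simp only [Set.insert_union, Set.singleton_union]
  have zU : f' {z, b i, b j} ≤ 2 := by
    have := hle {b i, b j} (by simp [Set.insert_subset_iff])
    rw [hUY, hWY] at this
    linarith
  have zV : f' {z, x, y} ≤ 2 := by
    have := hle {x, y} (by simp [Set.insert_subset_iff])
    rw [hVY, hWY] at this
    linarith
  have z1 : 1 ≤ f' {z} := by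
    rw [hWY] at hge
    linarith
  -- Two lines spanning a plane share rank at most 2 + 2 - 3.
  have z1' : f' {z} ≤ 1 := by
    have h1 := hp'.submodular {z, b i, b j} {z, x, y}
    have h2 : f' {z} ≤ f' ({z, b i, b j} ∩ {z, x, y}) := hp'.mono (by simp)
    have h3 : f' {b i, b j, x, y} ≤ f' ({z, b i, b j} ∪ {z, x, y}) :=
      hp'.mono (by simp [Set.insert_subset_iff])
    rw [hff' {b i, b j, x, y} (by simp [Set.insert_subset_iff, hbG', hxG, hyG])] at h3
    linarith
  -- As `b m` is off the line `x y`, it differs from `z`: submodularity gives `f' {b m, z} ≥ 3 + 1 -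
  -- 2`.
  have key : ∀ m, 3 ≤ f {b m, x, y} → 2 ≤ f' {b m, z} := by
    intro m hm
    have h1 := hp'.submodular {b m, z} {z, x, y}
    have h2 : f' {z} ≤ f' ({b m, z} ∩ {z, x, y}) := hp'.mono (by simp)
    have h3 : f' {b m, x, y} ≤ f' ({b m, z} ∪ {z, x, y}) :=
      hp'.mono (by simp [Set.insert_subset_iff])
    rw [hff' {b m, x, y} (by simp [Set.insert_subset_iff, hbG', hxG, hyG])] at h3
    linarith
  refine ⟨f', hf', hff', ⟨z1', ?_, ?_, ?_⟩, ?_⟩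
  · rw [hp'.mem_closure_iff, hff' {b i, b j} (by simp [Set.insert_subset_iff, hbG']),
      hf.rank_pair hij]
    exact zU
  · rw [hp'.mem_closure_iff]
    refine le_trans ?_ (key j rjV)
    rwa [Set.pair_comm, Set.insert_comm]
  · rw [hp'.mem_closure_iff]
    refine le_trans ?_ (key i riV)
    rwa [Set.insert_comm, Set.pair_comm, Set.insert_comm]
  · rwa [Set.insert_comm, Set.pair_comm z y] at zV

end Joints
end

noncomputable section

open Finset Filter Topology

/-! ### Collinearities forced by intersecting two planes -/

section Products

variable {E : Type*} {f : Set E → ℝ} {b : Fin 4 → E}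

theorem IsFrame.four_le (hf : IsFrame f b) {i j k l : Fin 4} (hij : i ≠ j) (hik : i ≠ k)
    (hil : i ≠ l) (hjk : j ≠ k) (hjl : j ≠ l) (hkl : k ≠ l) {A : Set E}
    (hi : b i ∈ polyClosure f A) (hj : b j ∈ polyClosure f A) (hk : b k ∈ polyClosure f A)
    (hl : b l ∈ polyClosure f A) : 4 ≤ f A := by
  rw [← hf.rank_quadruple hij hik hil hjk hjl hkl]
  exact hf.isPolymatroid.rank_le_of_subset_closure (Set.toFinite _)
    (by simp [Set.insert_subset_iff, hi, hj, hk, hl])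

theorem IsPolymatroid.rank_triple_le (hp : IsPolymatroid f) {x y z : E} (hx : f {x} ≤ 1)
    (hy : f {y} ≤ 1) (hz : f {z} ≤ 1) : f {x, y, z} ≤ 3 := by
  have h2 := hp.rank_insert_le x {y, z}
  have h3 := hp.rank_insert_le y {z}
  linarith

/-- If `t` is the product of `x` and `y` through `b k`, then it is also the product of the
corresponding points through `b l`. -/
theorem IsFrame.product_change_middle (hf : IsFrame f b) {i j k l : Fin 4} (hij : i ≠ j)
    (hik : i ≠ k) (hil : i ≠ l) (hjk : j ≠ k) (hjl : j ≠ l) (hkl : k ≠ l) {x y x' y' w t : E}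
    (hx : IsJoint f b i k x) (hy : IsJoint f b k j y) (hx' : IsJoint f b i l x')
    (hy' : IsJoint f b l j y') (hw : IsJoint f b k l w) (ht : IsJoint f b i j t)
    (hxw : f {x', w, x} ≤ 2) (hyw : f {y', w, y} ≤ 2) (hxyt : f {x, y, t} ≤ 2) :
    f {x', y', t} ≤ 2 := by
  have hp := hf.isPolymatroid
  -- The second plane contains `x` and `y`, by projection from `w`, and hence `t`. The planes differ
  -- because `b l` and `w` span `b k`.
  refine hp.rank_le_two_of_subset_closure (A := {b i, b j, b l}) (B := {x', y', w})
    (Set.toFinite _) ?_ ?_ (hf.rank_triple hij hil hjl).le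
    (hp.rank_triple_le hx'.rank_le hy'.rank_le hw.rank_le) ?_
  · have hs := hp.subset_closure {b i, b j, b l}
    simp only [Set.insert_subset_iff, Set.singleton_subset_iff] at hs ⊢
    obtain ⟨si, sj, sl⟩ := hs
    exact ⟨hx'.mem_of hp si sl, hy'.mem_of hp sl sj, ht.mem_of hp si sj⟩
  · have hs := hp.subset_closure {x', y', w}
    simp only [Set.insert_subset_iff, Set.singleton_subset_iff] at hs ⊢
    obtain ⟨sx, sy, sw⟩ := hs
    have h2 : f {x', w} = 2 := hf.rank_joint_pair hil hik hkl.symm hx' hw.symm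
    have h3 : f {y', w} = 2 := hf.rank_joint_pair hjl hjk hkl.symm hy'.symm hw.symm
    have h4 : f {x, y} = 2 := hf.rank_joint_pair hik hij hjk.symm hx hy
    exact ⟨sx, sy, hp.mem_closure_of_rank_le (hxyt.trans h4.ge)
      (hp.mem_closure_of_rank_le (hxw.trans h2.ge) sx sw)
      (hp.mem_closure_of_rank_le (hyw.trans h3.ge) sy sw)⟩
  · have hs := hp.subset_closure ({b i, b j, b l} ∪ {x', y', w})
    simp only [Set.insert_union, Set.singleton_union, Set.insert_subset_iff,
      Set.singleton_subset_iff] at hs ⊢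
    obtain ⟨si, sj, sl, -, -, sw⟩ := hs
    exact hf.four_le hij hik hil hjk hjl hkl si sj (hw.left_of hp sl sw) sl

/-- Products with a common right factor are coherent. -/
theorem IsFrame.product_coherence (hf : IsFrame f b) {i j k l : Fin 4} (hij : i ≠ j)
    (hik : i ≠ k) (hil : i ≠ l) (hjk : j ≠ k) (hjl : j ≠ l) (hkl : k ≠ l) {x y x' t t' w : E}
    (hx : IsJoint f b i l x) (hy : IsJoint f b l j y) (hx' : IsJoint f b k l x')
    (ht : IsJoint f b i j t) (ht' : IsJoint f b k j t') (hw : IsJoint f b i k w)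
    (hxyt : f {x, y, t} ≤ 2) (hxyt' : f {x', y, t'} ≤ 2) (hxw : f {x, w, x'} ≤ 2) :
    f {t, t', w} ≤ 2 := by
  have hp := hf.isPolymatroid
  -- The second plane contains `t`, then `x'` by way of `w`, and then `t'` as a point of the line
  -- `x' y`. It leaves the first plane because `b i` and `x` span `b l`.
  refine hp.rank_le_two_of_subset_closure (A := {b i, b j, b k}) (B := {x, y, w})
    (Set.toFinite _) ?_ ?_ (hf.rank_triple hij hik hjk).le
    (hp.rank_triple_le hx.rank_le hy.rank_le hw.rank_le) ?_
  · have hs := hp.subset_closure {b i, b j, b k}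
    simp only [Set.insert_subset_iff, Set.singleton_subset_iff] at hs ⊢
    obtain ⟨si, sj, sk⟩ := hs
    exact ⟨ht.mem_of hp si sj, ht'.mem_of hp sk sj, hw.mem_of hp si sk⟩
  · have hs := hp.subset_closure {x, y, w}
    simp only [Set.insert_subset_iff, Set.singleton_subset_iff] at hs ⊢
    obtain ⟨sx, sy, sw⟩ := hs
    have h2 : f {x, w} = 2 := by
      rw [Set.pair_comm]
      exact hf.rank_joint_pair hik.symm hkl hil hw.symm hx
    have h3 : f {x, y} = 2 := hf.rank_joint_pair hil hij hjl.symm hx hy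
    have h4 : f {x', y} = 2 := hf.rank_joint_pair hkl hjk.symm hjl.symm hx' hy
    exact ⟨hp.mem_closure_of_rank_le (hxyt.trans h3.ge) sx sy,
      hp.mem_closure_of_rank_le (hxyt'.trans h4.ge)
        (hp.mem_closure_of_rank_le (hxw.trans h2.ge) sx sw) sy, sw⟩
  · have hs := hp.subset_closure ({b i, b j, b k} ∪ {x, y, w})
    simp only [Set.insert_union, Set.singleton_union, Set.insert_subset_iff,
      Set.singleton_subset_iff] at hs ⊢
    obtain ⟨si, sj, sk, sx, -, -⟩ := hs
    exact hf.four_le hij hik hil hjk hjl hkl si sj sk (hx.right_of hp si sx)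

end Products

/-! ## Partial Dowling geometries inside a larger ground set -/

namespace PDGData

variable {E : Type u} {T : Type v}

/-- The combinatorial axioms of a partial Dowling geometry, which do not involve the rank. -/
structure IsSkeleton (Q : PDGData 4 E T) : Prop where
  inv_involutive : Function.Involutive Q.inv
  inv_e : Q.inv Q.e = Q.e
  bijective : Function.Bijective
    (Sum.elim Q.b (fun x : {p : Fin 4 × Fin 4 // p.1 < p.2} × T => Q.copy x.1 x.2))

variable {Q : PDGData 4 E T}

theorem IsSkeleton.elt_inv (hQ : Q.IsSkeleton) (s : T) {i j : Fin 4} (hij : i ≠ j) :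
    Q.elt (Q.inv s) i j hij = Q.elt s j i hij.symm := by
  unfold elt
  rcases lt_or_gt_of_ne hij with h | h
  · rw [dif_pos h, dif_neg h.not_gt]
  · rw [dif_neg h.not_gt, dif_pos h, hQ.inv_involutive]

theorem IsSkeleton.elt_e (hQ : Q.IsSkeleton) {i j : Fin 4} (hij : i ≠ j) :
    Q.elt Q.e i j hij = Q.elt Q.e j i hij.symm := by
  rw [← hQ.elt_inv, hQ.inv_e]

theorem IsSkeleton.b_injective (hQ : Q.IsSkeleton) : Function.Injective Q.b := fun i j h => by
  have := hQ.bijective.1 (a₁ := Sum.inl i) (a₂ := Sum.inl j) h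
  simpa using this

theorem IsSkeleton.elt_ne_b (hQ : Q.IsSkeleton) (s : T) {i j : Fin 4} (hij : i ≠ j)
    (k : Fin 4) : Q.elt s i j hij ≠ Q.b k := by
  intro h
  unfold elt at h
  split_ifs at h with hlt
  · have := hQ.bijective.1 (a₁ := Sum.inr (⟨(i, j), hlt⟩, s)) (a₂ := Sum.inl k) h
    simp at this
  · have := hQ.bijective.1 (a₁ := Sum.inr (⟨(j, i), _⟩, Q.inv s)) (a₂ := Sum.inl k) h
    simp at this

theorem IsSkeleton.elt_eq_elt (hQ : Q.IsSkeleton) {s s' : T} {i j i' j' : Fin 4} {hij : i ≠ j}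
    {hij' : i' ≠ j'} (h : Q.elt s i j hij = Q.elt s' i' j' hij') :
    (s = s' ∧ i = i' ∧ j = j') ∨ (Q.inv s = s' ∧ i = j' ∧ j = i') := by
  have hinj : ∀ {p p' : {p : Fin 4 × Fin 4 // p.1 < p.2}} {s s' : T},
      Q.copy p s = Q.copy p' s' → p = p' ∧ s = s' := by
    intro p p' s s' h
    have := hQ.bijective.1 (a₁ := Sum.inr (p, s)) (a₂ := Sum.inr (p', s')) h
    simpa using this
  unfold elt at h
  split_ifs at h with h1 h2 h2 <;> obtain ⟨h3, h4⟩ := hinj h <;>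
    simp only [Subtype.mk.injEq, Prod.mk.injEq] at h3 <;> obtain ⟨rfl, rfl⟩ := h3
  · exact Or.inl ⟨h4, rfl, rfl⟩
  · right
    rw [h4, hQ.inv_involutive]
    exact ⟨rfl, rfl, rfl⟩
  · exact Or.inr ⟨h4, rfl, rfl⟩
  · exact Or.inl ⟨hQ.inv_involutive.injective h4, rfl, rfl⟩

/-- The elements of the ground set that come from the basis and the generators in `F`. -/
def ground (Q : PDGData 4 E T) (F : Set T) : Set E :=
  {x | (∃ i, x = Q.b i) ∨ ∃ s ∈ F, ∃ (i j : Fin 4) (hij : i ≠ j), x = Q.elt s i j hij}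

theorem b_mem_ground (F : Set T) (i : Fin 4) : Q.b i ∈ Q.ground F := Or.inl ⟨i, rfl⟩

theorem elt_mem_ground {F : Set T} {s : T} (hs : s ∈ F) {i j : Fin 4} (hij : i ≠ j) :
    Q.elt s i j hij ∈ Q.ground F := Or.inr ⟨s, hs, i, j, hij, rfl⟩

theorem ground_mono {F F' : Set T} (h : F ⊆ F') : Q.ground F ⊆ Q.ground F' := by
  rintro x (hx | ⟨s, hs, hx⟩)
  · exact Or.inl hx
  · exact Or.inr ⟨s, h hs, hx⟩

theorem finite_ground {F : Set T} (hF : F.Finite) : (Q.ground F).Finite := by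
  have h1 : (Set.range Q.b).Finite := Set.finite_range _
  have h2 : (⋃ s ∈ F, Set.range fun p : {p : Fin 4 × Fin 4 // p.1 ≠ p.2} =>
      Q.elt s p.1.1 p.1.2 p.2).Finite := hF.biUnion fun s _ => Set.finite_range _
  refine (h1.union h2).subset ?_
  rintro x (⟨i, rfl⟩ | ⟨s, hs, i, j, hij, rfl⟩)
  · exact Or.inl ⟨i, rfl⟩
  · refine Or.inr ?_
    simp only [Set.mem_iUnion]
    exact ⟨s, hs, ⟨⟨(i, j), hij⟩, rfl⟩⟩

/-- The rank function `f` satisfies the axioms of a partial Dowling geometry with generators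
in `F`. -/
structure IsPartialPDG (Q : PDGData 4 E T) (F : Set T) (f : Set E → ℝ) : Prop where
  limit : IsEntropicLimit f
  frame : IsFrame f Q.b
  finite : F.Finite
  e_mem : Q.e ∈ F
  inv_mem : ∀ s ∈ F, Q.inv s ∈ F
  joint : ∀ s ∈ F, ∀ (i j : Fin 4) (hij : i ≠ j), IsJoint f Q.b i j (Q.elt s i j hij)
  coherence : ∀ s ∈ F, ∀ (i j k : Fin 4) (hij : i ≠ j) (hjk : j ≠ k) (hki : k ≠ i),
    f {Q.elt s i j hij, Q.elt (Q.inv s) j k hjk, Q.elt Q.e k i hki} ≤ 2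

end PDGData

theorem IsFrame.congr {E : Type*} {f f' : Set E → ℝ} {b : Fin 4 → E} (hf : IsFrame f b)
    (hp : IsPolymatroid f') {G : Set E} (hbG : ∀ i, b i ∈ G) (h : ∀ A ⊆ G, f' A = f A) :
    IsFrame f' b := by
  refine ⟨hp, hf.injective, fun A hA => ?_⟩
  rw [h A (hA.trans (by rintro _ ⟨i, rfl⟩; exact hbG i)), hf.rank_basis A hA]

theorem IsJoint.congr {E : Type*} {f f' : Set E → ℝ} {b : Fin 4 → E} {i j : Fin 4} {x : E}
    (hx : IsJoint f b i j x) {G : Set E} (hbG : ∀ i, b i ∈ G) (hxG : x ∈ G)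
    (h : ∀ A ⊆ G, f' A = f A) : IsJoint f' b i j x := by
  have key : ∀ (A : Set E) (y : E), A ⊆ G → y ∈ G → y ∈ polyClosure f A →
      y ∈ polyClosure f' A := by
    intro A y hA hy hyA
    rw [polyClosure, Set.mem_ofPred_eq] at hyA ⊢
    rw [h A hA, hyA, h _ (Set.union_subset hA (by simpa using hy))]
  exact ⟨(h {x} (by simpa using hxG)).le.trans hx.rank_le,
    key _ _ (by simp [Set.insert_subset_iff, hbG]) hxG hx.mem,
    key _ _ (by simp [Set.insert_subset_iff, hbG, hxG]) (hbG i) hx.left,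
    key _ _ (by simp [Set.insert_subset_iff, hbG, hxG]) (hbG j) hx.right⟩

/-! ### Adjoining one product to a partial geometry -/

namespace PDGData

variable {E : Type u} {T : Type v} {Q : PDGData 4 E T} {F : Set T} {f : Set E → ℝ}

theorem IsPartialPDG.congr (h : Q.IsPartialPDG F f) {f' : Set E → ℝ} (hlim : IsEntropicLimit f')
    (hff' : ∀ A ⊆ Q.ground F, f' A = f A) : Q.IsPartialPDG F f' where
  limit := hlim
  frame := h.frame.congr hlim.isPolymatroid (b_mem_ground F) hff'
  finite := h.finite
  e_mem := h.e_mem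
  inv_mem := h.inv_mem
  joint := fun s hs i j hij =>
    (h.joint s hs i j hij).congr (b_mem_ground F) (elt_mem_ground hs hij) hff'
  coherence := fun s hs i j k hij hjk hki => by
    rw [hff']
    · exact h.coherence s hs i j k hij hjk hki
    · simp [Set.insert_subset_iff, elt_mem_ground hs, elt_mem_ground (h.inv_mem s hs),
        elt_mem_ground h.e_mem]

/-- The coherence axiom read without inverses: projecting from `e_{i,k}` moves the first index of
`s`. The companion `coherence_left` moves the second. -/
theorem IsPartialPDG.coherence_right (hQ : Q.IsSkeleton) (h : Q.IsPartialPDG F f) {s : T}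
    (hs : s ∈ F) {i j k : Fin 4} (hij : i ≠ j) (hik : i ≠ k) (hkj : k ≠ j) :
    f {Q.elt s i j hij, Q.elt Q.e i k hik, Q.elt s k j hkj} ≤ 2 := by
  have := h.coherence s hs i j k hij hkj.symm hik.symm
  rwa [hQ.elt_inv, hQ.elt_e, Set.pair_comm] at this

theorem IsPartialPDG.coherence_left (hQ : Q.IsSkeleton) (h : Q.IsPartialPDG F f) {s : T}
    (hs : s ∈ F) {i j k : Fin 4} (hij : i ≠ j) (hjk : j ≠ k) (hik : i ≠ k) :
    f {Q.elt s i j hij, Q.elt Q.e j k hjk, Q.elt s i k hik} ≤ 2 := by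
  have := h.coherence_right hQ (h.inv_mem s hs) hij.symm hjk hik.symm
  rwa [hQ.elt_inv, hQ.elt_inv] at this

theorem exists_ne_of_ne : ∀ i j : Fin 4, i ≠ j → ∃ k l : Fin 4,
    i ≠ k ∧ i ≠ l ∧ j ≠ k ∧ j ≠ l ∧ k ≠ l := by decide

theorem exists_fourth : ∀ i j k : Fin 4, ∃ l : Fin 4, i ≠ l ∧ j ≠ l ∧ k ≠ l := by decide

/-- Adding the elements `t_{i,j}` of a product of `a` and `c`. -/
theorem IsPartialPDG.exists_product_points (hQ : Q.IsSkeleton) (h : Q.IsPartialPDG F f)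
    {a c t : T} (ha : a ∈ F) (hc : c ∈ F) (ht : t ∉ F) (ht' : Q.inv t ∉ F) (htt : Q.inv t ≠ t)
    (D : Finset {p : Fin 4 × Fin 4 // p.1 ≠ p.2}) :
    ∃ f' : Set E → ℝ, IsEntropicLimit f' ∧ (∀ A ⊆ Q.ground F, f' A = f A) ∧
      ∀ p ∈ D, IsJoint f' Q.b p.1.1 p.1.2 (Q.elt t p.1.1 p.1.2 p.2) ∧
        ∃ (k : Fin 4) (hik : p.1.1 ≠ k) (hkj : k ≠ p.1.2),
          f' {Q.elt a p.1.1 k hik, Q.elt c k p.1.2 hkj, Q.elt t p.1.1 p.1.2 p.2} ≤ 2 := by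
  classical
  induction D using Finset.induction_on with
  | empty => exact ⟨f, h.limit, fun _ _ => rfl, by simp⟩
  | @insert p D hpD ih =>
    obtain ⟨f₁, hlim, hff₁, hD⟩ := ih
    have h₁ := h.congr hlim hff₁
    obtain ⟨⟨i, j⟩, hij⟩ := p
    obtain ⟨k, l, hik, hil, hjk, hjl, hkl⟩ := exists_ne_of_ne i j hij
    -- Points already placed for other ordered pairs must be kept fixed too, so they belong to `G`.
    set G : Set E := Q.ground F ∪ (fun p : {p : Fin 4 × Fin 4 // p.1 ≠ p.2} =>
      Q.elt t p.1.1 p.1.2 p.2) '' (D : Set _) with hG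
    have hFG : Q.ground F ⊆ G := Set.subset_union_left
    have hGfin : G.Finite := (finite_ground h.finite).union (D.finite_toSet.image _)
    -- The condition `Q.inv t ≠ t` separates `t_{i,j}` from `t_{j,i}`, so every ordered pair gives a
    -- fresh element.
    have hz : Q.elt t i j hij ∉ G := by
      rintro ((⟨m, hm⟩ | ⟨s, hs, i', j', hij', he⟩) | ⟨⟨⟨i', j'⟩, hij'⟩, hp', he⟩)
      · exact hQ.elt_ne_b _ _ _ hm
      · rcases hQ.elt_eq_elt he with ⟨rfl, -, -⟩ | ⟨rfl, -, -⟩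
        · exact ht hs
        · exact ht' hs
      · rcases hQ.elt_eq_elt he with ⟨-, rfl, rfl⟩ | ⟨h', -, -⟩
        · exact hpD hp'
        · exact htt h'
    obtain ⟨f₂, hlim₂, hff₂, hj₂, hr₂⟩ := hlim.exists_joint h₁.frame hij hik hil hjk hjl hkl
      (h₁.joint a ha i k hik) (h₁.joint c hc k j hjk.symm) (h₁.joint a ha i l hil)
      (h₁.joint c hc l j hjl.symm) (h₁.joint _ h.e_mem k l hkl)
      (by rw [hQ.elt_e]; exact h₁.coherence_left hQ ha hil hkl.symm hik)
      (by rw [hQ.elt_e]; exact h₁.coherence_right hQ hc hjl.symm hkl.symm hjk.symm) hGfin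
      (by rintro _ ⟨m, rfl⟩; exact hFG (b_mem_ground F m)) (hFG (elt_mem_ground ha hik))
      (hFG (elt_mem_ground hc hjk.symm)) (hFG (elt_mem_ground ha hil))
      (hFG (elt_mem_ground hc hjl.symm)) hz
    refine ⟨f₂, hlim₂, fun A hA => by rw [hff₂ A (hA.trans hFG), hff₁ A hA], fun p hp => ?_⟩
    rcases Finset.mem_insert.mp hp with rfl | hp
    · exact ⟨hj₂, k, hik, hjk.symm, hr₂⟩
    · obtain ⟨hj, k', hik', hkj', hr⟩ := hD p hp
      have hpG : Q.elt t p.1.1 p.1.2 p.2 ∈ G := Or.inr ⟨p, hp, rfl⟩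
      refine ⟨hj.congr (fun m => hFG (b_mem_ground F m)) hpG hff₂, k', hik', hkj', ?_⟩
      rw [hff₂]
      · exact hr
      · simp [Set.insert_subset_iff, hpG, hFG (elt_mem_ground ha hik'),
          hFG (elt_mem_ground hc hkj')]

/-- A geometric product of `a` and `c` can be added. -/
theorem IsPartialPDG.exists_product (hQ : Q.IsSkeleton) (h : Q.IsPartialPDG F f)
    {a c t : T} (ha : a ∈ F) (hc : c ∈ F) (ht : t ∉ F) (ht' : Q.inv t ∉ F)
    (htt : Q.inv t ≠ t) :
    ∃ f' : Set E → ℝ, Q.IsPartialPDG (F ∪ {t, Q.inv t}) f' ∧ (∀ A ⊆ Q.ground F, f' A = f A) ∧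
      ∀ (i j k : Fin 4) (hik : i ≠ k) (hkj : k ≠ j) (hij : i ≠ j),
        f' {Q.elt a i k hik, Q.elt c k j hkj, Q.elt t i j hij} ≤ 2 := by
  obtain ⟨f', hlim, hff', hD⟩ := h.exists_product_points hQ ha hc ht ht' htt univ
  have h' := h.congr hlim hff'
  have hf := h'.frame
  have hjt : ∀ (i j : Fin 4) (hij : i ≠ j), IsJoint f' Q.b i j (Q.elt t i j hij) :=
    fun i j hij => (hD ⟨(i, j), hij⟩ (mem_univ _)).1
  have hrel : ∀ (i j k : Fin 4) (hik : i ≠ k) (hkj : k ≠ j) (hij : i ≠ j),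
      f' {Q.elt a i k hik, Q.elt c k j hkj, Q.elt t i j hij} ≤ 2 := by
    intro i j l hil hlj hij
    obtain ⟨-, k, hik, hkj, hr⟩ := hD ⟨(i, j), hij⟩ (mem_univ _)
    change i ≠ k at hik
    change k ≠ j at hkj
    -- The construction used one middle index `k`; any other index `l` is reached by projecting from
    -- `e_{k,l}`.
    rcases eq_or_ne k l with rfl | hkl
    · exact hr
    · exact hf.product_change_middle hij hik hil hkj.symm hlj.symm hkl (h'.joint a ha i k hik)
        (h'.joint c hc k j hkj) (h'.joint a ha i l hil) (h'.joint c hc l j hlj)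
        (h'.joint _ h.e_mem k l hkl) (hjt i j hij)
        (by rw [hQ.elt_e]; exact h'.coherence_left hQ ha hil hkl.symm hik)
        (by rw [hQ.elt_e]; exact h'.coherence_right hQ hc hlj hkl.symm hkj) hr
  refine ⟨f', ⟨hlim, hf, h.finite.union (Set.toFinite _), Or.inl h.e_mem, ?_, ?_, ?_⟩, hff', hrel⟩
  · rintro s (hs | rfl | rfl)
    · exact Or.inl (h.inv_mem s hs)
    · exact Or.inr (Or.inr rfl)
    · rw [hQ.inv_involutive]
      exact Or.inr (Or.inl rfl)
  · rintro s (hs | rfl | rfl) i j hij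
    · exact h'.joint s hs i j hij
    · exact hjt i j hij
    · rw [hQ.elt_inv]
      exact (hjt j i hij.symm).symm
  · rintro s (hs | rfl | rfl) i j k hij hjk hki
    · exact h'.coherence s hs i j k hij hjk hki
    -- Through the fourth index `l`, both `t_{i,j}` and `t_{k,j}` are products with the same right
    -- factor `c_{l,j}`.
    · obtain ⟨l, hil, hjl, hkl⟩ := exists_fourth i j k
      rw [hQ.elt_inv, hQ.elt_e]
      exact hf.product_coherence hij hki.symm hil hjk hjl hkl (h'.joint a ha i l hil)
        (h'.joint c hc l j hjl.symm) (h'.joint a ha k l hkl) (hjt i j hij) (hjt k j hjk.symm)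
        (h'.joint _ h.e_mem i k hki.symm) (hrel i j l hil hjl.symm hij)
        (hrel k j l hkl hjl.symm hjk.symm) (h'.coherence_right hQ ha hil hki.symm hkl)
    -- The same argument with all joints reversed: `t_{j,i}` and `t_{j,k}` share the left factor
    -- `a_{j,l}`.
    · obtain ⟨l, hil, hjl, hkl⟩ := exists_fourth i j k
      rw [hQ.inv_involutive, hQ.elt_inv, hQ.elt_e]
      refine hf.product_coherence hij hki.symm hil hjk hjl hkl (h'.joint c hc l i hil.symm).symm
        (h'.joint a ha j l hjl).symm (h'.joint c hc l k hkl.symm).symm (hjt j i hij.symm).symm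
        (hjt j k hjk).symm (h'.joint _ h.e_mem i k hki.symm) ?_ ?_
        (h'.coherence_left hQ hc hil.symm hki.symm hkl.symm)
      · rw [Set.insert_comm]
        exact hrel j i l hjl hil.symm hij.symm
      · rw [Set.insert_comm]
        exact hrel j k l hjl hkl.symm hjk

end PDGData

end

noncomputable section

open Finset Filter Topology

namespace PDGData

/-! ## Unions of chains of partial Dowling geometries -/

section Chain

variable {E : Type u} {T : Type v} {Q : PDGData 4 E T} {F : Set T} {f : Set E → ℝ}

theorem IsPartialPDG.rank_ground_le (h : Q.IsPartialPDG F f) : f (Q.ground F) ≤ 4 := by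
  have hp := h.frame.isPolymatroid
  have h1 := h.frame.rank_image univ
  rw [Finset.coe_univ, Set.image_univ, Finset.card_univ, Fintype.card_fin] at h1
  have h2 := hp.subset_closure (Set.range Q.b)
  refine (hp.rank_le_of_subset_closure (finite_ground h.finite) ?_).trans h1.le
  rintro x (⟨i, rfl⟩ | ⟨s, hs, i, j, hij, rfl⟩)
  · exact h2 ⟨i, rfl⟩
  · exact (h.joint s hs i j hij).mem_of hp (h2 ⟨i, rfl⟩) (h2 ⟨j, rfl⟩)

/-- Two joints on adjacent lines already have rank 2, so recording only upper bounds for collinear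
triples loses nothing. -/
theorem IsPartialPDG.relator_eq_two (h : Q.IsPartialPDG F f) {s t : T}
    (hs : s ∈ F) (ht : t ∈ F) {i j k : Fin 4} (hij : i ≠ j) (hjk : j ≠ k) (hki : k ≠ i) {x : E}
    (hx : f {Q.elt s i j hij, Q.elt t j k hjk, x} ≤ 2) :
    f {Q.elt s i j hij, Q.elt t j k hjk, x} = 2 := by
  refine le_antisymm hx ?_
  rw [← h.frame.rank_joint_pair hij hki.symm hjk (h.joint s hs i j hij) (h.joint t ht j k hjk)]
  exact h.frame.isPolymatroid.mono (by simp [Set.insert_subset_iff])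

/-- The union of a chain of partial Dowling geometries. -/
theorem exists_union (hQ : Q.IsSkeleton) {F : ℕ → Set T} {f : ℕ → Set E → ℝ}
    (h : ∀ n, Q.IsPartialPDG (F n) (f n)) (hF : Monotone F)
    (hf : ∀ n, ∀ A ⊆ Q.ground (F n), f (n + 1) A = f n A) (hcover : ∀ s, ∃ n, s ∈ F n) :
    ∃ r : Set E → ℝ, IsAlmostEntropic r ∧ ({ Q with rank := r } : PDGData 4 E T).IsPDG ∧
      ∀ n, ∀ A ⊆ Q.ground (F n), r A = f n A := by
  have hG : Monotone fun n => Q.ground (F n) := fun m n hmn => ground_mono (hF hmn)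
  have hfm : ∀ n m, n ≤ m → ∀ A ⊆ Q.ground (F n), f m A = f n A := by
    intro n m hnm A hA
    induction m, hnm using Nat.le_induction with
    | base => rfl
    | succ m hnm ih => rw [hf m A (hA.trans (hG hnm)), ih]
  have hp := fun n => (h n).frame.isPolymatroid
  have hmono : ∀ A, Monotone fun n => f n (A ∩ Q.ground (F n)) := by
    intro A m n hmn
    change f m _ ≤ f n _
    rw [← hfm m n hmn _ Set.inter_subset_right]
    exact hp n |>.mono (Set.inter_subset_inter_right _ (hG hmn))
  have hbdd : ∀ A, BddAbove (Set.range fun n => f n (A ∩ Q.ground (F n))) := by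
    intro A
    refine ⟨4, ?_⟩
    rintro _ ⟨n, rfl⟩
    exact ((hp n).mono Set.inter_subset_right).trans (h n).rank_ground_le
  -- The supremum over finite stages makes `r` of finite type; the bound 4 from the basis makes it
  -- finite.
  set r : Set E → ℝ := fun A => ⨆ n, f n (A ∩ Q.ground (F n)) with hr
  have hlim : ∀ A, Tendsto (fun n => f n (A ∩ Q.ground (F n))) atTop (𝓝 (r A)) :=
    fun A => tendsto_atTop_ciSup (hmono A) (hbdd A)
  have hrf : ∀ n, ∀ A ⊆ Q.ground (F n), r A = f n A := by
    intro n A hA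
    refine tendsto_nhds_unique (hlim A) (tendsto_const_nhds.congr' ?_)
    filter_upwards [eventually_ge_atTop n] with m hm
    rw [Set.inter_eq_left.mpr (hA.trans (hG hm)), hfm n m hm A hA]
  have hrlim : IsEntropicLimit r := by
    -- Diagonal sequence: the `n`-th approximation is accurate to `1 / (n + 1)` on the `n`-th stage
    -- and trivial outside it.
    choose g hg hgf using fun n : ℕ => (h n).limit.exists_approx (finite_ground (h n).finite)
      (ε := 1 / ((n : ℝ) + 1)) (by positivity)
    refine ⟨fun n A => g n (A ∩ Q.ground (F n)), fun n => (hg n).inter _, fun A => ?_⟩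
    have h1 : Tendsto (fun n => g n (A ∩ Q.ground (F n)) - f n (A ∩ Q.ground (F n))) atTop
        (𝓝 0) := by
      refine squeeze_zero_norm (fun n => ?_) tendsto_one_div_add_atTop_nhds_zero_nat
      rw [Real.norm_eq_abs]
      exact (hgf n _ Set.inter_subset_right).le
    simpa using h1.add (hlim A)
  have hrp := hrlim.isPolymatroid
  have hpart : ∀ n, Q.IsPartialPDG (F n) r := fun n => (h n).congr hrlim (hrf n)
  refine ⟨r, ⟨hrp, fun A => ⟨?_, fun u hu => ?_⟩, hrlim⟩, ?_, hrf⟩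
  · rintro _ ⟨B, -, hBA, rfl⟩
    exact hrp.mono hBA
  · refine ciSup_le fun n => ?_
    rw [← hrf n _ Set.inter_subset_right]
    exact hu ⟨_, (finite_ground (h n).finite).subset Set.inter_subset_right,
      Set.inter_subset_left, rfl⟩
  · have hfr := (hpart 0).frame
    have hj : ∀ (s : T) (i j : Fin 4) (hij : i ≠ j), IsJoint r Q.b i j (Q.elt s i j hij) := by
      intro s i j hij
      obtain ⟨n, hn⟩ := hcover s
      exact (hpart n).joint s hn i j hij
    refine ⟨hrp, hQ.inv_involutive, hQ.inv_e, hQ.bijective, hfr.rank_basis,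
      fun s i j hij => (hj s i j hij).mem, fun s i j hij => hfr.rank_joint hij (hj s i j hij),
      fun s i j hij => hfr.rank_left_joint hij (hj s i j hij), fun s i j k hij hjk hki => ?_⟩
    obtain ⟨n, hn⟩ := hcover s
    exact (hpart n).relator_eq_two hn ((hpart n).inv_mem s hn) hij hjk hki
      ((hpart n).coherence s hn i j k hij hjk hki)

end Chain

end PDGData

/-! ## Formal products -/

/-- Formal products of elements of `S` and their formal inverses. -/
inductive ProductTerm (S : Type v) : Type v
  | base (s : S) : ProductTerm S
  | prod (a c : ProductTerm S) : ProductTerm S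
  | prodInv (a c : ProductTerm S) : ProductTerm S

namespace ProductTerm

variable {S : Type v}

/-- The formal inverse. -/
def inv (i : S → S) : ProductTerm S → ProductTerm S
  | base s => base (i s)
  | prod a c => prodInv a c
  | prodInv a c => prod a c

theorem inv_involutive {i : S → S} (hi : Function.Involutive i) :
    Function.Involutive (inv i) := by
  rintro (s | ⟨a, c⟩ | ⟨a, c⟩)
  · simp [inv, hi s]
  · rfl
  · rfl

theorem base_injective : Function.Injective (base : S → ProductTerm S) := fun _ _ h => by
  injection h

/-- The formal products of depth at most `n`. -/
def level : ℕ → Set (ProductTerm S)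
  | 0 => Set.range base
  | n + 1 => level n ∪ (Set.image2 prod (level n) (level n) ∪
      Set.image2 prodInv (level n) (level n))

theorem level_mono : Monotone (level (S := S)) :=
  monotone_nat_of_le_succ fun _ => Set.subset_union_left

theorem exists_mem_level (t : ProductTerm S) : ∃ n, t ∈ level n := by
  have key : ∀ {a c : ProductTerm S}, (∃ n, a ∈ level n) → (∃ n, c ∈ level n) →
      ∃ n, a ∈ level n ∧ c ∈ level n := by
    rintro a c ⟨m, hm⟩ ⟨n, hn⟩
    exact ⟨max m n, level_mono (le_max_left _ _) hm, level_mono (le_max_right _ _) hn⟩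
  induction t with
  | base s => exact ⟨0, s, rfl⟩
  | prod a c iha ihc =>
    obtain ⟨n, ha, hc⟩ := key iha ihc
    exact ⟨n + 1, Or.inr (Or.inl ⟨a, ha, c, hc, rfl⟩)⟩
  | prodInv a c iha ihc =>
    obtain ⟨n, ha, hc⟩ := key iha ihc
    exact ⟨n + 1, Or.inr (Or.inr ⟨a, ha, c, hc, rfl⟩)⟩

/-- Countable types are small in every universe, which lets the new ground set live in the universe
of the old one. -/
instance [Countable S] : Countable (ProductTerm S) := by
  have h : ∀ n, (level (S := S) n).Countable := by
    intro n
    induction n with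
    | zero => exact Set.countable_range _
    | succ n ih => exact ih.union ((ih.image2 ih _).union (ih.image2 ih _))
  rw [← Set.countable_univ_iff]
  exact (Set.countable_iUnion h).mono fun t _ => Set.mem_iUnion.mpr (exists_mem_level t)

end ProductTerm

/-! ### Closing up under formal products -/

namespace PDGData

section Closed

variable {S : Type v} {E : Type u} {Q : PDGData 4 E (ProductTerm S)}

/-- A partial Dowling geometry in which all formal products are geometric products. -/
structure IsProductPDG (Q : PDGData 4 E (ProductTerm S)) (F : Set (ProductTerm S))
    (f : Set E → ℝ) : Prop where
  isPartialPDG : Q.IsPartialPDG F f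
  prod_mem : ∀ a c, .prod a c ∈ F → a ∈ F ∧ c ∈ F
  prod_rank : ∀ a c, .prod a c ∈ F → ∀ (i j k : Fin 4) (hik : i ≠ k) (hkj : k ≠ j)
    (hij : i ≠ j), f {Q.elt a i k hik, Q.elt c k j hkj, Q.elt (.prod a c) i j hij} ≤ 2

theorem IsProductPDG.exists_step (hQ : Q.IsSkeleton) {ν : S → S}
    (hν : Q.inv = ProductTerm.inv ν) {F : Set (ProductTerm S)} {f : Set E → ℝ}
    (h : Q.IsProductPDG F f) (D : Finset (ProductTerm S × ProductTerm S))
    (hD : ∀ p ∈ D, p.1 ∈ F ∧ p.2 ∈ F) :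
    ∃ (F' : Set (ProductTerm S)) (f' : Set E → ℝ), Q.IsProductPDG F' f' ∧ F ⊆ F' ∧
      (∀ A ⊆ Q.ground F, f' A = f A) ∧ ∀ p ∈ D, .prod p.1 p.2 ∈ F' := by
  classical
  induction D using Finset.induction_on with
  | empty => exact ⟨F, f, h, subset_rfl, fun _ _ => rfl, by simp⟩
  | @insert p D _ ih =>
    obtain ⟨F₁, f₁, h₁, hF₁, hf₁, hD₁⟩ := ih fun p hp => hD p (mem_insert_of_mem hp)
    obtain ⟨a, c⟩ := p
    by_cases hmem : .prod a c ∈ F₁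
    · refine ⟨F₁, f₁, h₁, hF₁, hf₁, fun p hp => ?_⟩
      rcases mem_insert.mp hp with rfl | hp
      · exact hmem
      · exact hD₁ p hp
    · obtain ⟨ha, hc⟩ := hD _ (mem_insert_self _ _)
      have hinv : Q.inv (.prod a c) = .prodInv a c := by rw [hν]; rfl
      -- A formal product and its formal inverse enter together, since each stage is closed under
      -- inversion.
      have hmem' : Q.inv (.prod a c) ∉ F₁ := fun h' => hmem (by
        simpa [hQ.inv_involutive (.prod a c)] using h₁.isPartialPDG.inv_mem _ h')
      obtain ⟨f₂, h₂, hf₂, hr₂⟩ := h₁.isPartialPDG.exists_product hQ (hF₁ ha) (hF₁ hc) hmem hmem'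
        (by rw [hinv]; exact fun h => by cases h)
      have hpm : ∀ x y, .prod x y ∈ F₁ ∪ {.prod a c, Q.inv (.prod a c)} →
          .prod x y ∈ F₁ ∨ (x = a ∧ y = c) := by
        rintro x y (hxy | hxy | hxy)
        · exact Or.inl hxy
        · right
          injection hxy with h1 h2
          exact ⟨h1, h2⟩
        · rw [hinv] at hxy
          cases hxy
      refine ⟨_, f₂, ⟨h₂, fun x y hxy => ?_, fun x y hxy => ?_⟩,
        hF₁.trans Set.subset_union_left,
        fun A hA => by rw [hf₂ A (hA.trans (ground_mono hF₁)), hf₁ A hA], fun p hp => ?_⟩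
      · rcases hpm x y hxy with hxy | ⟨rfl, rfl⟩
        · exact ⟨Or.inl (h₁.prod_mem x y hxy).1, Or.inl (h₁.prod_mem x y hxy).2⟩
        · exact ⟨Or.inl (hF₁ ha), Or.inl (hF₁ hc)⟩
      · rcases hpm x y hxy with hxy | ⟨rfl, rfl⟩
        · intro i j k hik hkj hij
          obtain ⟨hx, hy⟩ := h₁.prod_mem x y hxy
          rw [hf₂]
          · exact h₁.prod_rank x y hxy i j k hik hkj hij
          · simp [Set.insert_subset_iff, elt_mem_ground hx, elt_mem_ground hy,
              elt_mem_ground hxy]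
        · exact hr₂
      · rcases mem_insert.mp hp with rfl | hp
        · exact Or.inr (Or.inl rfl)
        · exact Or.inl (hD₁ p hp)

/-- Closing up under formal products. -/
theorem IsPartialPDG.exists_isProductClosed (hQ : Q.IsSkeleton) {ν : S → S}
    (hν : Q.inv = ProductTerm.inv ν) {f₀ : Set E → ℝ}
    (h₀ : Q.IsPartialPDG (Set.range .base) f₀) :
    ∃ r : Set E → ℝ, IsAlmostEntropic r ∧
      ({ Q with rank := r } : PDGData 4 E (ProductTerm S)).IsPDG ∧
      ({ Q with rank := r } : PDGData 4 E (ProductTerm S)).IsProductClosed ∧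
      ∀ A ⊆ Q.ground (Set.range .base), r A = f₀ A := by
  classical
  have hstep : ∀ x : {x : Set (ProductTerm S) × (Set E → ℝ) // Q.IsProductPDG x.1 x.2},
      ∃ y : {x : Set (ProductTerm S) × (Set E → ℝ) // Q.IsProductPDG x.1 x.2},
        x.1.1 ⊆ y.1.1 ∧ (∀ A ⊆ Q.ground x.1.1, y.1.2 A = x.1.2 A) ∧
        ∀ a ∈ x.1.1, ∀ c ∈ x.1.1, .prod a c ∈ y.1.1 := by
    rintro ⟨⟨F, f⟩, h⟩
    have hfin := h.isPartialPDG.finite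
    obtain ⟨F', f', h', hF, hf, hD⟩ := h.exists_step hQ hν (hfin.prod hfin).toFinset
      (fun p hp => by simpa using hp)
    exact ⟨⟨⟨F', f'⟩, h'⟩, hF, hf, fun a ha c hc => hD (a, c) (by simpa using ⟨ha, hc⟩)⟩
  choose next hnext1 hnext2 hnext3 using hstep
  -- No base element is a formal product, so the product conditions hold vacuously at the start.
  let start : {x : Set (ProductTerm S) × (Set E → ℝ) // Q.IsProductPDG x.1 x.2} :=
    ⟨⟨Set.range .base, f₀⟩, h₀, fun a c h => by simp at h, fun a c h => by simp at h⟩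
  let x : ℕ → {x : Set (ProductTerm S) × (Set E → ℝ) // Q.IsProductPDG x.1 x.2} :=
    fun n => n.rec start fun _ y => next y
  have hmono : Monotone fun n => (x n).1.1 := monotone_nat_of_le_succ fun n => hnext1 (x n)
  have key : ∀ {a c : ProductTerm S}, (∃ n, a ∈ (x n).1.1) → (∃ n, c ∈ (x n).1.1) →
      ∃ n, .prod a c ∈ (x n).1.1 := by
    rintro a c ⟨m, hm⟩ ⟨n, hn⟩
    exact ⟨max m n + 1, hnext3 (x (max m n)) a (hmono (le_max_left m n) hm) c
      (hmono (le_max_right m n) hn)⟩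
  have hcover : ∀ s, ∃ n, s ∈ (x n).1.1 := by
    intro s
    induction s with
    | base s => exact ⟨0, s, rfl⟩
    | prod a c iha ihc => exact key iha ihc
    | prodInv a c iha ihc =>
      obtain ⟨n, hn⟩ := key iha ihc
      refine ⟨n, ?_⟩
      have := (x n).2.isPartialPDG.inv_mem _ hn
      rw [hν] at this
      exact this
  obtain ⟨r, hr, hrP, hrf⟩ := exists_union hQ (fun n => (x n).2.isPartialPDG) hmono
    (fun n => hnext2 (x n)) hcover
  refine ⟨r, hr, hrP, fun a c => ⟨.prod a c, fun i k j hik hkj hji => ?_⟩, hrf 0⟩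
  obtain ⟨n, hn⟩ := hcover (.prod a c)
  obtain ⟨ha, hc⟩ := (x n).2.prod_mem a c hn
  -- The third element of the relator is `(t⁻¹)_{j,i} = t_{i,j}`, the point constructed with middle
  -- index `k`.
  change r {Q.elt a i k hik, Q.elt c k j hkj, Q.elt (Q.inv (.prod a c)) j i hji} = 2
  rw [hQ.elt_inv, hrf n]
  · exact (x n).2.isPartialPDG.relator_eq_two ha hc hik hkj hji
      ((x n).2.prod_rank a c hn i j k hik hkj hji.symm)
  · simp [Set.insert_subset_iff, elt_mem_ground ha, elt_mem_ground hc, elt_mem_ground hn]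

end Closed

/-! ## Partial Dowling geometries as partial structures -/

section Transport

variable {E : Type u} {S : Type v} {P : PDGData 4 E S}

theorem IsPDG.isSkeleton (hP : P.IsPDG) : P.IsSkeleton :=
  ⟨hP.inv_involutive, hP.inv_e, hP.bijective⟩

theorem IsPDG.isFrame (hP : P.IsPDG) : IsFrame P.rank P.b :=
  ⟨hP.isPolymatroid, hP.isSkeleton.b_injective, hP.rank_basis⟩

/-- The axiom for `s⁻¹` with exchanged indices gives `b_j` and `s_{i,j}` rank 2 as well, so either
basis point together with `s_{i,j}` spans the line. -/
theorem IsPDG.isJoint (hP : P.IsPDG) (s : S) {i j : Fin 4} (hij : i ≠ j) :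
    IsJoint P.rank P.b i j (P.elt s i j hij) := by
  have hp := hP.isPolymatroid
  have h1 := hp.mem_closure_iff.mp (hP.frame s i j hij)
  rw [hP.isFrame.rank_pair hij] at h1
  have h2 := hP.rank_basis_elt s i j hij
  have h3 := hP.rank_basis_elt (P.inv s) j i hij.symm
  rw [hP.isSkeleton.elt_inv] at h3
  refine ⟨(hP.rank_elt s i j hij).le, hP.frame s i j hij, ?_, ?_⟩
  · rw [hp.mem_closure_iff, h3]
    rwa [Set.pair_comm, Set.insert_comm]
  · rw [hp.mem_closure_iff, h2]
    rwa [Set.insert_comm, Set.pair_comm, Set.insert_comm]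

theorem elt_eq_copy (P : PDGData 4 E S) (p : {p : Fin 4 × Fin 4 // p.1 < p.2}) (s : S) :
    P.elt s p.1.1 p.1.2 p.2.ne = P.copy p s := by
  unfold elt
  rw [dif_pos p.2]

end Transport

end PDGData

/-! ### Transport along an injection and the final assembly -/

theorem IsJoint.map {E E' : Type*} {f : Set E → ℝ} {b : Fin 4 → E} {i j : Fin 4} {x : E}
    (hx : IsJoint f b i j x) {ι : E → E'} (hι : Function.Injective ι) :
    IsJoint (fun A => f (ι ⁻¹' A)) (ι ∘ b) i j (ι x) := by
  have key : ∀ (A : Set E) (y : E), y ∈ polyClosure f A →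
      ι y ∈ polyClosure (fun A => f (ι ⁻¹' A)) (ι '' A) := by
    intro A y hy
    rw [polyClosure, Set.mem_ofPred_eq] at hy ⊢
    rw [← Set.image_singleton, ← Set.image_union, Set.preimage_image_eq _ hι,
      Set.preimage_image_eq _ hι, hy]
  refine ⟨?_, ?_, ?_, ?_⟩
  · rw [← Set.image_singleton, Set.preimage_image_eq _ hι]
    exact hx.rank_le
  · simpa [Set.image_insert_eq] using key _ _ hx.mem
  · simpa [Set.image_insert_eq] using key _ _ hx.left
  · simpa [Set.image_insert_eq] using key _ _ hx.right

theorem IsFrame.map {E E' : Type*} {f : Set E → ℝ} {b : Fin 4 → E} (hf : IsFrame f b)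
    {ι : E → E'} (hι : Function.Injective ι) (hp : IsPolymatroid fun A => f (ι ⁻¹' A)) :
    IsFrame (fun A => f (ι ⁻¹' A)) (ι ∘ b) := by
  refine ⟨hp, hι.comp hf.injective, fun A hA => ?_⟩
  rw [Set.range_comp] at hA
  obtain ⟨B, hB, rfl⟩ := Set.subset_image_iff.mp hA
  rw [Set.preimage_image_eq _ hι, hf.rank_basis B hB, Set.ncard_image_of_injective _ hι]

end

theorem mainTheorem5 {E : Type u} {S : Type v} [Finite E] (P : PDGData 4 E S)
    (hP : P.IsPDG) (hent : IsAlmostEntropic P.rank) :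
    ∃ (E' : Type u) (S' : Type v) (Q : PDGData 4 E' S') (ι : E ↪ E') (κ : S ↪ S'),
      Q.IsPDG ∧ IsAlmostEntropic Q.rank ∧ P.IsExtension Q ι κ ∧ Q.IsProductClosed := by
  have : Finite S := Finite.of_injective (P.copy ⟨(0, 1), by decide⟩) fun s s' h => by
    have := hP.bijective.1 (a₁ := Sum.inr (⟨(0, 1), by decide⟩, s))
      (a₂ := Sum.inr (⟨(0, 1), by decide⟩, s')) h
    simpa using this
  let U := Fin 4 ⊕ {p : Fin 4 × Fin 4 // p.1 < p.2} × ProductTerm S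
  have : Small.{u} U := inferInstance
  let φ : U ≃ Shrink.{u} U := equivShrink U
  let Q : PDGData 4 (Shrink.{u} U) (ProductTerm S) :=
    { rank := fun _ => 0
      inv := ProductTerm.inv P.inv
      e := .base P.e
      b := fun i => φ (.inl i)
      copy := fun p t => φ (.inr (p, t)) }
  let ε := Equiv.ofBijective _ hP.bijective
  let ι : E → Shrink.{u} U := fun x => φ (Sum.map id (Prod.map id .base) (ε.symm x))
  have hι : Function.Injective ι := φ.injective.comp
    ((Sum.map_injective.mpr ⟨Function.injective_id,
      Function.injective_id.prodMap ProductTerm.base_injective⟩).comp ε.symm.injective)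
  have hιb : ∀ i, ι (P.b i) = Q.b i := fun i => by
    have : ε.symm (P.b i) = .inl i := ε.symm_apply_eq.mpr rfl
    simp only [ι, this]
    rfl
  have hιcopy : ∀ p s, ι (P.copy p s) = Q.copy p (.base s) := fun p s => by
    have : ε.symm (P.copy p s) = .inr (p, s) := ε.symm_apply_eq.mpr rfl
    simp only [ι, this]
    rfl
  have hιelt : ∀ (s : S) (i j : Fin 4) (hij : i ≠ j),
      Q.elt (.base s) i j hij = ι (P.elt s i j hij) := by
    intro s i j hij
    unfold PDGData.elt
    split_ifs
    · exact (hιcopy _ _).symm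
    · exact (hιcopy _ _).symm
  have hQ : Q.IsSkeleton := by
    refine ⟨ProductTerm.inv_involutive hP.inv_involutive, congrArg _ hP.inv_e, ?_⟩
    convert φ.bijective using 1
    ext (i | x) <;> rfl
  -- On the enlarged ground set the points not yet constructed start as loops.
  have hlim : IsEntropicLimit fun A : Set (Shrink.{u} U) => P.rank (ι ⁻¹' A) :=
    IsEntropicLimit.preimage hent.exists_limit ι
  have hb : ι ∘ P.b = Q.b := funext hιb
  have h₀ : Q.IsPartialPDG (Set.range .base) fun A => P.rank (ι ⁻¹' A) := by
    refine ⟨hlim, hb ▸ hP.isFrame.map hι hlim.isPolymatroid, Set.finite_range _, ⟨P.e, rfl⟩,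
      ?_, ?_, ?_⟩
    · rintro _ ⟨s, rfl⟩
      exact ⟨P.inv s, rfl⟩
    · rintro _ ⟨s, rfl⟩ i j hij
      rw [hιelt, ← hb]
      exact (hP.isJoint s hij).map hι
    · rintro _ ⟨s, rfl⟩ i j k hij hjk hki
      have h1 : Q.inv (.base s) = .base (P.inv s) := rfl
      have h2 : Q.e = .base P.e := rfl
      rw [h1, h2, hιelt, hιelt, hιelt]
      have h3 := hP.coherence s i j k hij hjk hki
      rw [← Set.preimage_image_eq {P.elt s i j hij, _, _} hι] at h3
      simpa only [Set.image_insert_eq, Set.image_singleton] using h3.le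
  obtain ⟨r, hr, hrP, hrc, hr₀⟩ := h₀.exists_isProductClosed hQ rfl
  refine ⟨Shrink.{u} U, ProductTerm S, { Q with rank := r }, ⟨ι, hι⟩,
    ⟨.base, ProductTerm.base_injective⟩, hrP, hr,
    ⟨fun A => ?_, fun s => rfl, rfl, hιb, hιcopy⟩, hrc⟩
  change r (ι '' A) = P.rank A
  rw [hr₀, Set.preimage_image_eq _ hι]
  rintro _ ⟨x, -, rfl⟩
  obtain ⟨y, rfl⟩ := hP.bijective.2 x
  rcases y with i | ⟨p, s⟩
  · exact Or.inl ⟨i, hιb i⟩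
  · refine Or.inr ⟨.base s, ⟨s, rfl⟩, p.1.1, p.1.2, p.2.ne, ?_⟩
    rw [PDGData.elt_eq_copy]
    exact hιcopy p s
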